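/- **Saddle point lemma.** Let $a<b$ be real numbers, let $f,\varphi$ be complex functions, and assume: 1. for $x\in[a,b]$ the value $f(x)$ is real and $f''(x)>0$; 2. there is a function $\mu\in C^1([a,b])$ with $\mu(x)>0$ such that $f$ and $\varphi$ are holomorphic on (a neighbourhood of) the set $\bigcup_{x\in[a,b]}\overline{D}(x,\mu(x))$, where $\overline{D}(x,r)$ is the closed disc with centre $x$ and radius $r$; 3. there are positive functions $F,\Phi$ on $[a,b]$ and positive constants $A_1,A_2,A_3$ such that for all $x\in[a,b]$ and $z\in\overline{D}(x,\mu(x))$ we have $f''(z)\neq 0$ and $$|\varphi(z)|\le A_1\Phi(x),\qquad |f'(z)|\le A_2\frac{F(x)}{\mu(x)},\qquad \frac1{|f''(z)|}\le A_3\frac{\mu(x)^2}{F(x)}.$$ Let $k\in\mathbb R$ and $$0<\alpha_0<\min\left\{\frac{1}{\left(1+\frac{2A_2A_3}{3}\right)\sqrt2},\ \frac{A_3(1+2A_2)}{2},\ \left(\frac{48A_3^3}{\pi^3}\right)^{1/6}\right\}.$$ Put $$\beta=\frac{2\alpha_0\sqrt2A_2A_3}{3(1-\alpha_0\sqrt2)},\qquad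 \omega_1=\pi\alpha_0^3A_2\left(\frac{4\sqrt2}{3}+\frac{27\alpha_0}{2^7(1-\alpha_0\sqrt2)}\right),$$ $$\omega_2=e^{\omega_1}\left(\frac{4\pi A_2}{3}\right)^2\left(1+\frac{3\alpha_0}{\sqrt2-2\alpha_0}\left(1+\frac{3\sqrt2\,\alpha_0}{8(1-\alpha_0\sqrt2)}\right)\right),$$ $$\omega_3=\frac{4\pi\sqrt2A_2}{3}+\frac{2\pi\alpha_0A_2}{1-\alpha_0\sqrt2}+\alpha_0^3\omega_2,$$ $$B_1=\frac1{1-\beta}+\frac1\pi\exp\left(-\frac{\pi}{2(1-\beta)}\right),\qquad B_2=\frac{2\pi\alpha_0^2(1-\beta)}{A_3(1+2A_2)},\qquad B_3=\frac{48\sqrt2}{\pi^4\alpha_0^7}\left(1+(1-\beta)^{-4}\right),$$ $$B_4=\frac{1+\alpha_0^3\omega_3}{(2\pi/A_3)(1-\alpha_0\sqrt2)}+\frac{3}{(4\pi/A_3)^2}\left(\frac{2\pi A_2}{1-\alpha_0\sqrt2}+\omega_3\sqrt2\right)+\frac{15\,\omega_2}{(4\pi/A_3)^3}.$$ (i) If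 $x_0\in[a,b]$ satisfies $f'(x_0)=-k$, then $$\int_a^b\varphi(x)e^{2\pi i(f(x)+kx)}\,dx=\frac{\varphi(x_0)}{\sqrt{f''(x_0)}}\,e^{2\pi i\left(f(x_0)+kx_0+\frac18\right)}+\mathcal R_1+\mathcal R_2+\mathcal R_3.$$ (ii) If there is no such $x_0$ in $[a,b]$, then $$\int_a^b\varphi(x)e^{2\pi i(f(x)+kx)}\,dx=\mathcal R_1+\mathcal R_2.$$ Here $\mathcal R_1,\mathcal R_2,\mathcal R_3$ are complex numbers with $$|\mathcal R_1|\le A_1B_1\left(\frac{\Phi(a)}{|f'(a)+k|+\sqrt{f''(a)}}+\frac{\Phi(b)}{|f'(b)+k|+\sqrt{f''(b)}}\right),$$ $$|\mathcal R_2|\le A_1\int_a^b\Phi(x)e^{B_2(-|k|\mu(x)-F(x))}\left(1+\alpha_0\sqrt2\,|\mu'(x)|\right)dx,$$ $$|\mathcal R_3|\le A_1\left(A_3^4B_3+\sqrt{A_3}\,B_4\right)\Phi(x_0)\mu(x_0)F(x_0)^{-3/2},$$ where the integral in the bound for $\mathcal R_2$ is a Lebesgue integral with values in $[0,\infty]$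 (a lower Lebesgue integral if its integrand is not measurable). -/

import Mathlib

open scoped Real

namespace SaddlePoint

noncomputable section

/-- The exponential integral `∫_a^b φ(x) e^{2πi(f(x)+kx)} dx`. -/
def expIntegral (a b k : ℝ) (φ f : ℂ → ℂ) : ℂ :=
  ∫ x in a..b, φ (x : ℂ) *
    Complex.exp (2 * (π : ℂ) * Complex.I * (f (x : ℂ) + (k : ℂ) * (x : ℂ)))

/-- `β(A₂, A₃, α₀)`. -/
def beta (A₂ A₃ α₀ : ℝ) : ℝ :=
  (2 * α₀ * √2 * A₂ * A₃) / (3 * (1 - α₀ * √2))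

/-- `ω₁(A₂, α₀)`. -/
def omega1 (A₂ α₀ : ℝ) : ℝ :=
  π * α₀ ^ 3 * A₂ * (4 * √2 / 3 + 27 * α₀ / (2 ^ 7 * (1 - α₀ * √2)))

/-- `ω₂(A₂, α₀)`. -/
def omega2 (A₂ α₀ : ℝ) : ℝ :=
  Real.exp (omega1 A₂ α₀) * (4 * π * A₂ / 3) ^ 2 *
    (1 + 3 * α₀ / (√2 - 2 * α₀) * (1 + 3 * √2 * α₀ / (8 * (1 - α₀ * √2))))

/-- `ω₃(A₂, α₀)`. -/
def omega3 (A₂ α₀ : ℝ) : ℝ :=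
  4 * π * √2 * A₂ / 3 + 2 * π * α₀ * A₂ / (1 - α₀ * √2) + α₀ ^ 3 * omega2 A₂ α₀

/-- `B₁(A₂, A₃, α₀)`. -/
def B1 (A₂ A₃ α₀ : ℝ) : ℝ :=
  1 / (1 - beta A₂ A₃ α₀) + 1 / π * Real.exp (-(π / (2 * (1 - beta A₂ A₃ α₀))))

/-- `B₂(A₂, A₃, α₀)`. -/
def B2 (A₂ A₃ α₀ : ℝ) : ℝ :=
  2 * π * α₀ ^ 2 * (1 - beta A₂ A₃ α₀) / (A₃ * (1 + 2 * A₂))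

/-- `B₃(A₂, A₃, α₀)`. -/
def B3 (A₂ A₃ α₀ : ℝ) : ℝ :=
  48 * √2 / (π ^ 4 * α₀ ^ 7) * (1 + ((1 - beta A₂ A₃ α₀) ^ 4)⁻¹)

/-- `B₄(A₂, A₃, α₀)`. -/
def B4 (A₂ A₃ α₀ : ℝ) : ℝ :=
  (1 + α₀ ^ 3 * omega3 A₂ α₀) / (2 * π / A₃ * (1 - α₀ * √2))
    + 3 / (4 * π / A₃) ^ 2 * (2 * π * A₂ / (1 - α₀ * √2) + omega3 A₂ α₀ * √2)
    + 15 * omega2 A₂ α₀ / (4 * π / A₃) ^ 3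

/-- The bound for the first remainder,
`A₁ B₁ (Φ(a) / (|f'(a)+k| + √f''(a)) + Φ(b) / (|f'(b)+k| + √f''(b)))`. -/
def bound1 (a b k : ℝ) (f : ℂ → ℂ) (Φ : ℝ → ℝ) (A₁ A₂ A₃ α₀ : ℝ) : ℝ :=
  A₁ * B1 A₂ A₃ α₀ *
    (Φ a / (‖deriv f (a : ℂ) + (k : ℂ)‖ + √((deriv (deriv f) (a : ℂ)).re))
      + Φ b / (‖deriv f (b : ℂ) + (k : ℂ)‖ + √((deriv (deriv f) (b : ℂ)).re)))

/-- The bound for the second remainder,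
`A₁ ∫_a^b Φ(x) e^{B₂(-|k| μ(x) - F(x))} (1 + α₀ √2 |μ'(x)|) dx`, as a Lebesgue integral with
values in `[0, ∞]`: the functions `F` and `Φ` are merely positive, so that this integral need
not be finite. -/
def bound2 (a b k : ℝ) (F Φ μ : ℝ → ℝ) (A₁ A₂ A₃ α₀ : ℝ) : ENNReal :=
  ENNReal.ofReal A₁ * ∫⁻ x in Set.Icc a b, ENNReal.ofReal
    (Φ x * Real.exp (B2 A₂ A₃ α₀ * (-|k| * μ x - F x)) *
      (1 + α₀ * √2 * |derivWithin μ (Set.Icc a b) x|))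

/-- The bound for the third remainder,
`A₁ (A₃⁴ B₃ + √A₃ B₄) Φ(x₀) μ(x₀) F(x₀)^{-3/2}`. -/
def bound3 (x₀ : ℝ) (F Φ μ : ℝ → ℝ) (A₁ A₂ A₃ α₀ : ℝ) : ℝ :=
  A₁ * (A₃ ^ 4 * B3 A₂ A₃ α₀ + √A₃ * B4 A₂ A₃ α₀) * Φ x₀ * μ x₀ *
    (F x₀) ^ (-(3 / 2) : ℝ)

/-- The main term `φ(x₀) / √f''(x₀) · e^{2πi(f(x₀) + k x₀ + 1/8)}`. -/
def mainTerm (k x₀ : ℝ) (φ f : ℂ → ℂ) : ℂ :=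
  φ (x₀ : ℂ) / ((√((deriv (deriv f) (x₀ : ℂ)).re) : ℝ) : ℂ) *
    Complex.exp (2 * (π : ℂ) * Complex.I * (f (x₀ : ℂ) + (k : ℂ) * (x₀ : ℂ) + 1 / 8))

end

end SaddlePoint

/-! Write h(z) = φ(z) e^{2πi(f(z)+kz)}. The real segment is pushed to the curve x + ε(1+i)α₀μ(x),
where ε is the sign of f'(x)+k. Because ((1+i)s)² = 2is², the linear and the quadratic Taylor terms
of the phase both make h decay in this direction. The Taylor remainder is controlled by Cauchy's
estimates for f' and by F ≤ A₃μ²f''; it uses up at most the share β < 1 of the quadratic decay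
(`norm_phase_sub_quadratic_le`, `norm_integrand_le`).

Since f'' > 0, f'+k is increasing and changes sign at most once. If it has no zero, one shift
(`integral_contour_shift`) yields segments at a and b, which form R₁, and a curve, which is R₂. If
it vanishes at x₀, the interval is cut there and the two halves are shifted in opposite directions.
The two extra segments at x₀ then join into one straight segment through the saddle in the direction
1+i, where the quadratic part of the phase gives a real Gaussian.

On that segment the values at s and -s are added (`norm_symmetrized_sub_le`). The linear term of φ
and the cubic term of the phase cancel to first order, so the relative error against the Gaussian is
of order s² + Fs⁴ + F²s⁶, and its Gaussian moments produce the F^{-3/2} in R₃. The expansion is used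
only for s ≤ η, with η of order F^{-1/3} when F is not small; beyond η crude Gaussian tails suffice
(`gaussian_tails_le`). The completed Gaussian is the main term. -/

namespace SaddlePoint

open MeasureTheory Set

/-! ### Taylor remainders from Cauchy's estimates -/

/-- The variable is rescaled to the unit disc, so the tail of the series is dominated by a geometric
series in ‖z‖. Only the coefficients from index m on need a bound, which lets the derivative version
below gain a factor 1/m. -/
theorem norm_sub_taylor_le {f : ℂ → ℂ} {x : ℂ} {r C : ℝ} (hr : 0 < r)
    (hf : AnalyticOnNhd ℂ f (Metric.closedBall x r)) {m : ℕ}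
    (hC : ∀ n, m ≤ n → ‖iteratedDeriv n f x‖ * r ^ n ≤ n.factorial * C)
    {z : ℂ} (hz : ‖z‖ < 1) :
    ‖f (x + r * z) - ∑ n ∈ Finset.range m, (iteratedDeriv n f x * r ^ n / n.factorial) * z ^ n‖
      ≤ C * ‖z‖ ^ m / (1 - ‖z‖) := by
  have hmem : x + r * z ∈ Metric.ball x r := by
    simp only [Metric.mem_ball, dist_self_add_left, norm_mul, Complex.norm_real, Real.norm_eq_abs,
      abs_of_pos hr]
    nlinarith
  have hd : DifferentiableOn ℂ f (Metric.ball x r) :=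
    (hf.mono Metric.ball_subset_closedBall).differentiableOn
  have hs := Complex.hasSum_taylorSeries_on_ball hd hmem
  have hs' : HasSum (fun n : ℕ => (iteratedDeriv n f x * r ^ n / n.factorial) * z ^ n)
      (f (x + r * z)) := by
    convert! hs using 2 with n
    simp only [add_sub_cancel_left, smul_eq_mul, mul_pow]
    ring
  have ht := (hasSum_nat_add_iff' m).2 hs'
  have hg : HasSum (fun n : ℕ => C * ‖z‖ ^ m * ‖z‖ ^ n) (C * ‖z‖ ^ m / (1 - ‖z‖)) := by
    rw [div_eq_mul_inv]
    exact (hasSum_geometric_of_lt_one (norm_nonneg _) hz).mul_left _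
  rw [← ht.tsum_eq]
  refine tsum_of_norm_bounded hg fun n => ?_
  have h1 := hC (n + m) (by omega)
  have hfac : (0 : ℝ) < (n + m).factorial := by positivity
  rw [norm_mul, norm_div, norm_mul, norm_pow, norm_pow, Complex.norm_natCast, Complex.norm_real,
    Real.norm_eq_abs, abs_of_pos hr, mul_assoc, ← pow_add, add_comm m n]
  gcongr
  rw [div_le_iff₀ hfac, mul_comm C]
  exact h1

theorem norm_iteratedDeriv_mul_pow_le {f : ℂ → ℂ} {x : ℂ} {r C : ℝ} (hr : 0 < r)
    (hf : AnalyticOnNhd ℂ f (Metric.closedBall x r))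
    (hC : ∀ z ∈ Metric.closedBall x r, ‖f z‖ ≤ C) (n : ℕ) :
    ‖iteratedDeriv n f x‖ * r ^ n ≤ n.factorial * C := by
  have hd : DiffContOnCl ℂ f (Metric.ball x r) := by
    refine DifferentiableOn.diffContOnCl ?_
    rw [closure_ball _ hr.ne']
    exact hf.differentiableOn
  have := Complex.norm_iteratedDeriv_le_of_forall_mem_sphere_norm_le n hr hd
    fun z hz => hC z (Metric.sphere_subset_closedBall hz)
  rwa [le_div_iff₀ (by positivity)] at this

/-- Cauchy's estimate applied to f' bounds the n-th scaled coefficient of f by rC/n, hence by rC/m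
for n ≥ m. -/
theorem norm_sub_taylor_le_of_norm_deriv_le {f : ℂ → ℂ} {x : ℂ} {r C : ℝ} (hr : 0 < r)
    (hf : AnalyticOnNhd ℂ f (Metric.closedBall x r))
    (hC : ∀ z ∈ Metric.closedBall x r, ‖deriv f z‖ ≤ C) {m : ℕ} (hm : 0 < m)
    {z : ℂ} (hz : ‖z‖ < 1) :
    ‖f (x + r * z) - ∑ n ∈ Finset.range m, (iteratedDeriv n f x * r ^ n / n.factorial) * z ^ n‖
      ≤ (r * C / m) * ‖z‖ ^ m / (1 - ‖z‖) := by
  refine norm_sub_taylor_le hr hf (fun n hn => ?_) hz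
  obtain ⟨n, rfl⟩ : ∃ j, n = j + 1 := ⟨n - 1, by omega⟩
  have h := norm_iteratedDeriv_mul_pow_le hr hf.deriv hC n
  have hm' : (0 : ℝ) < m := by exact_mod_cast hm
  have hn' : (m : ℝ) ≤ n + 1 := by exact_mod_cast hn
  have hC0 : 0 ≤ C := (norm_nonneg _).trans (hC x (Metric.mem_closedBall_self hr.le))
  rw [iteratedDeriv_succ', pow_succ, Nat.factorial_succ, ← mul_assoc]
  push_cast
  calc _ ≤ (n.factorial * C) * r := by gcongr
    _ = m * n.factorial * (r * C / m) := by field_simp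
    _ ≤ _ := by gcongr

/-- Termwise comparison of series, by (n+2)! ≥ 2·n!. -/
theorem exp_sub_one_sub_id_le {t : ℝ} (ht : 0 ≤ t) :
    Real.exp t - 1 - t ≤ t ^ 2 / 2 * Real.exp t := by
  have hsum : HasSum (fun n : ℕ => t ^ n / n.factorial) (Real.exp t) := by
    rw [Real.exp_eq_exp_ℝ]; exact NormedSpace.expSeries_div_hasSum_exp t
  have h2 := (hasSum_nat_add_iff' 2).2 hsum
  have h3 := hsum.mul_left (t ^ 2 / 2)
  have := hasSum_le (fun n => ?_) h2 h3
  · simpa [Finset.sum_range_succ, sub_sub] using this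
  · have : ((n + 2).factorial : ℝ) ≥ 2 * n.factorial := by
      rw [Nat.factorial_succ, Nat.factorial_succ]
      push_cast
      have : (0 : ℝ) ≤ n.factorial := by positivity
      nlinarith [mul_nonneg (Nat.cast_nonneg (α := ℝ) n) this,
        mul_nonneg (mul_nonneg (Nat.cast_nonneg (α := ℝ) n) (Nat.cast_nonneg (α := ℝ) n)) this]
    rw [pow_add, div_mul_div_comm, mul_comm (t ^ n)]
    gcongr

theorem norm_exp_sub_one_sub_id_le_half (w : ℂ) :
    ‖Complex.exp w - 1 - w‖ ≤ ‖w‖ ^ 2 / 2 * Real.exp ‖w‖ := by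
  have := Complex.norm_exp_sub_sum_le_exp_norm_sub_sum w 2
  simp only [Finset.sum_range_succ, Finset.sum_range_zero, zero_add, pow_zero, Nat.factorial,
    Nat.cast_one, div_one, pow_one, mul_one, ← sub_sub] at this
  exact this.trans (exp_sub_one_sub_id_le (norm_nonneg w))

/-! ### Deformation of the contour -/

/-- With p(x,t) = x + ctμ(x), the form h(p)dp is closed, so its integral around the rectangle [a,b]
× [0,1] vanishes. Working in the parameters avoids any geometry of the curved region, which may
overlap itself. -/
theorem integral_contour_shift {a b : ℝ} (hab : a ≤ b) {h : ℂ → ℂ} {μ ν : ℝ → ℝ} {c : ℂ}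
    (hμ : ∀ x ∈ Icc a b, HasDerivWithinAt μ (ν x) (Icc a b) x) (hν : ContinuousOn ν (Icc a b))
    (hh : ∀ x ∈ Icc a b, ∀ t ∈ Icc (0 : ℝ) 1, AnalyticAt ℂ h (x + c * t * μ x)) :
    ∫ x in a..b, h x = (∫ t in (0 : ℝ)..1, h (a + c * t * μ a) * (c * μ a))
      + (∫ x in a..b, h (x + c * μ x) * (1 + c * ν x))
      - ∫ t in (0 : ℝ)..1, h (b + c * t * μ b) * (c * μ b) := by
  set p : ℝ × ℝ → ℂ := fun q => q.1 + c * q.2 * μ q.1 with hp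
  have hμc : ContinuousOn μ (Icc a b) := fun x hx => (hμ x hx).continuousWithinAt
  have hfst : MapsTo (Prod.fst : ℝ × ℝ → ℝ) (Icc a b ×ˢ Icc (0 : ℝ) 1) (Icc a b) := fun q hq => hq.1
  have hμ2 : ContinuousOn (fun q : ℝ × ℝ => (μ q.1 : ℂ)) (Icc a b ×ˢ Icc (0 : ℝ) 1) :=
    Complex.continuous_ofReal.comp_continuousOn (hμc.comp continuousOn_fst hfst)
  have hν2 : ContinuousOn (fun q : ℝ × ℝ => (ν q.1 : ℂ)) (Icc a b ×ˢ Icc (0 : ℝ) 1) :=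
    Complex.continuous_ofReal.comp_continuousOn (hν.comp continuousOn_fst hfst)
  have hsnd : ContinuousOn (fun q : ℝ × ℝ => (q.2 : ℂ)) (Icc a b ×ˢ Icc (0 : ℝ) 1) := by fun_prop
  have hfst' : ContinuousOn (fun q : ℝ × ℝ => (q.1 : ℂ)) (Icc a b ×ˢ Icc (0 : ℝ) 1) := by fun_prop
  have hν3 : ContinuousOn (fun q : ℝ × ℝ => 1 + c * q.2 * ν q.1) (Icc a b ×ˢ Icc (0 : ℝ) 1) := by fun_prop
  have hpc : ContinuousOn p (Icc a b ×ˢ Icc (0 : ℝ) 1) := by fun_prop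
  have hhp : ContinuousOn (fun q => h (p q)) (Icc a b ×ˢ Icc (0 : ℝ) 1) := fun q hq =>
    (hh q.1 hq.1 q.2 hq.2).continuousAt.comp_continuousWithinAt (f := p) (hpc q hq)
  have hdp : ContinuousOn (fun q => deriv h (p q)) (Icc a b ×ˢ Icc (0 : ℝ) 1) := fun q hq =>
    (hh q.1 hq.1 q.2 hq.2).deriv.continuousAt.comp_continuousWithinAt (f := p) (hpc q hq)
  set W : ℝ × ℝ → ℂ := fun q => h (p q) * (c * μ q.1) with hW
  set V : ℝ × ℝ → ℂ := fun q => h (p q) * (1 + c * q.2 * ν q.1) with hV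
  -- `K` is both ∂W/∂x and ∂V/∂t. It involves only the first derivative of μ, so C¹ is enough;
  -- Fubini for `K` then gives the claim.
  set K : ℝ × ℝ → ℂ := fun q => deriv h (p q) * (1 + c * q.2 * ν q.1) * (c * μ q.1)
    + h (p q) * (c * ν q.1) with hK
  have hWc : ContinuousOn W (Icc a b ×ˢ Icc (0 : ℝ) 1) :=
    hhp.mul (continuousOn_const.mul hμ2)
  have hVc : ContinuousOn V (Icc a b ×ˢ Icc (0 : ℝ) 1) :=
    hhp.mul hν3
  have hKc : ContinuousOn K (Icc a b ×ˢ Icc (0 : ℝ) 1) :=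
    ((hdp.mul hν3).mul (continuousOn_const.mul hμ2)).add (hhp.mul (continuousOn_const.mul hν2))
  have slice1 : ∀ {G : ℝ × ℝ → ℂ}, ContinuousOn G (Icc a b ×ˢ Icc (0 : ℝ) 1) →
      ∀ t ∈ Icc (0 : ℝ) 1, ContinuousOn (fun x => G (x, t)) (Icc a b) := fun hG t ht =>
    hG.comp (by fun_prop) fun x hx => ⟨hx, ht⟩
  have slice2 : ∀ {G : ℝ × ℝ → ℂ}, ContinuousOn G (Icc a b ×ˢ Icc (0 : ℝ) 1) →
      ∀ x ∈ Icc a b, ContinuousOn (fun t => G (x, t)) (Icc (0 : ℝ) 1) := fun hG x hx =>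
    hG.comp (by fun_prop) fun t ht => ⟨hx, ht⟩
  have hII : ∀ {g : ℝ → ℂ} {u v : ℝ}, u ≤ v → ContinuousOn g (Icc u v) →
      IntervalIntegrable g volume u v := fun huv hg =>
    ContinuousOn.intervalIntegrable (by rwa [uIcc_of_le huv])
  have ftc1 : ∀ t ∈ Icc (0 : ℝ) 1, ∫ x in a..b, K (x, t) = W (b, t) - W (a, t) := by
    intro t ht
    refine intervalIntegral.integral_eq_sub_of_hasDerivAt_of_le hab (slice1 hWc t ht)
      (fun x hx => ?_) (hII hab (slice1 hKc t ht))
    have hx' := Ioo_subset_Icc_self hx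
    have hμx : HasDerivAt μ (ν x) x := (hμ x hx').hasDerivAt (Icc_mem_nhds hx.1 hx.2)
    have h1 : HasDerivAt (fun x : ℝ => (μ x : ℂ)) (ν x) x := hμx.ofReal_comp
    have h2 : HasDerivAt (fun x : ℝ => p (x, t)) (1 + c * t * ν x) x :=
      (Complex.ofRealCLM.hasDerivAt (x := x)).add (h1.const_mul (c * t))
    have h3 : HasDerivAt h (deriv h (p (x, t))) (p (x, t)) :=
      (hh x hx' t ht).differentiableAt.hasDerivAt
    exact (h3.comp x h2).mul (h1.const_mul c)
  have ftc2 : ∀ x ∈ Icc a b, ∫ t in (0 : ℝ)..1, K (x, t) = V (x, 1) - V (x, 0) := by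
    intro x hx
    refine intervalIntegral.integral_eq_sub_of_hasDerivAt_of_le zero_le_one (slice2 hVc x hx)
      (fun t ht => ?_) (hII zero_le_one (slice2 hKc x hx))
    have ht' := Ioo_subset_Icc_self ht
    have h1 : HasDerivAt (fun t : ℝ => (t : ℂ)) 1 t := Complex.ofRealCLM.hasDerivAt (x := t)
    have h2 : HasDerivAt (fun t : ℝ => p (x, t)) (c * 1 * μ x) t :=
      ((h1.const_mul c).mul_const (μ x : ℂ)).const_add (x : ℂ)
    have h3 : HasDerivAt h (deriv h (p (x, t))) (p (x, t)) :=
      (hh x hx t ht').differentiableAt.hasDerivAt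
    have h4 : HasDerivAt (fun t : ℝ => 1 + c * t * ν x) (c * 1 * ν x) t :=
      ((h1.const_mul c).mul_const (ν x : ℂ)).const_add 1
    refine ((h3.comp t h2).mul h4).congr_deriv ?_
    simp only [hK, Function.comp]
    ring
  have hswap : ∫ x in a..b, ∫ t in (0 : ℝ)..1, K (x, t)
      = ∫ t in (0 : ℝ)..1, ∫ x in a..b, K (x, t) := by
    simp only [intervalIntegral.integral_of_le hab, intervalIntegral.integral_of_le zero_le_one]
    refine integral_integral_swap (f := fun x t => K (x, t)) ?_
    rw [Measure.prod_restrict, ← Measure.volume_eq_prod]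
    exact (hKc.integrableOn_compact (isCompact_Icc.prod isCompact_Icc)).mono_set
      (prod_mono Ioc_subset_Icc_self Ioc_subset_Icc_self)
  have e1 : ∫ x in a..b, ∫ t in (0 : ℝ)..1, K (x, t)
      = (∫ x in a..b, V (x, 1)) - ∫ x in a..b, V (x, 0) := by
    rw [← intervalIntegral.integral_sub (hII hab (slice1 hVc 1 (by simp)))
      (hII hab (slice1 hVc 0 (by simp)))]
    refine intervalIntegral.integral_congr fun x hx => ?_
    rw [uIcc_of_le hab] at hx
    exact ftc2 x hx
  have e2 : ∫ t in (0 : ℝ)..1, ∫ x in a..b, K (x, t)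
      = (∫ t in (0 : ℝ)..1, W (b, t)) - ∫ t in (0 : ℝ)..1, W (a, t) := by
    rw [← intervalIntegral.integral_sub (hII zero_le_one (slice2 hWc b (right_mem_Icc.2 hab)))
      (hII zero_le_one (slice2 hWc a (left_mem_Icc.2 hab)))]
    refine intervalIntegral.integral_congr fun t ht => ?_
    rw [uIcc_of_le zero_le_one] at ht
    exact ftc1 t ht
  rw [hswap, e2] at e1
  simp only [hV, hW, hp, Complex.ofReal_one, Complex.ofReal_zero, mul_one, mul_zero, zero_mul,
    add_zero] at e1
  linear_combination e1

/-! ### Gaussian moments, tails and endpoint integrals -/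

theorem integrableOn_pow_mul_exp_neg_mul_sq {b : ℝ} (hb : 0 < b) (n : ℕ) :
    IntegrableOn (fun t : ℝ => t ^ n * Real.exp (-b * t ^ 2)) (Ioi 0) := by
  have := integrableOn_rpow_mul_exp_neg_mul_sq hb (s := n)
    (by linarith [Nat.cast_nonneg (α := ℝ) n])
  simpa only [Real.rpow_natCast] using this

theorem integral_even_pow_mul_exp_neg_mul_sq {b : ℝ} (hb : 0 < b) (n : ℕ) :
    ∫ t in Ioi (0 : ℝ), t ^ (2 * n) * Real.exp (-b * t ^ 2)
      = Real.Gamma (n + 1 / 2) / (2 * b ^ n * √b) := by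
  have h := integral_rpow_mul_exp_neg_mul_rpow (p := 2) (q := (2 * n : ℕ)) (b := b) two_pos
    (by linarith [Nat.cast_nonneg (α := ℝ) (2 * n)]) hb
  simp only [Real.rpow_natCast, Real.rpow_two] at h
  rw [h, show (((2 * n : ℕ) : ℝ) + 1) / 2 = n + 1 / 2 by push_cast; ring,
    show -(((2 * n : ℕ) : ℝ) + 1) / 2 = -(n + 1 / 2) by push_cast; ring, Real.rpow_neg hb.le,
    Real.rpow_add hb, Real.rpow_natCast, ← Real.sqrt_eq_rpow]
  field_simp

theorem integral_exp_neg_mul_sq_Ioi_zero {b : ℝ} :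
    ∫ t in Ioi (0 : ℝ), Real.exp (-b * t ^ 2) = √(π / b) / 2 := integral_gaussian_Ioi b

theorem integral_sq_mul_exp_neg_mul_sq {b : ℝ} (hb : 0 < b) :
    ∫ t in Ioi (0 : ℝ), t ^ 2 * Real.exp (-b * t ^ 2) = √(π / b) / 2 * (1 / (2 * b)) := by
  have h := integral_even_pow_mul_exp_neg_mul_sq hb 1
  rw [Real.Gamma_nat_add_half] at h
  rw [h, Real.sqrt_div Real.pi_pos.le]
  norm_num
  field_simp

theorem integral_pow_four_mul_exp_neg_mul_sq {b : ℝ} (hb : 0 < b) :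
    ∫ t in Ioi (0 : ℝ), t ^ 4 * Real.exp (-b * t ^ 2) = √(π / b) / 2 * (3 / (2 * b) ^ 2) := by
  have h := integral_even_pow_mul_exp_neg_mul_sq hb 2
  rw [Real.Gamma_nat_add_half] at h
  rw [h, Real.sqrt_div Real.pi_pos.le]
  norm_num [Nat.doubleFactorial]
  field_simp
  norm_num

theorem integral_pow_six_mul_exp_neg_mul_sq {b : ℝ} (hb : 0 < b) :
    ∫ t in Ioi (0 : ℝ), t ^ 6 * Real.exp (-b * t ^ 2) = √(π / b) / 2 * (15 / (2 * b) ^ 3) := by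
  have h := integral_even_pow_mul_exp_neg_mul_sq hb 3
  rw [Real.Gamma_nat_add_half] at h
  rw [h, Real.sqrt_div Real.pi_pos.le]
  norm_num [Nat.doubleFactorial]
  field_simp
  norm_num

theorem integrableOn_exp_neg_mul_sq {b : ℝ} (hb : 0 < b) (s : Set ℝ) :
    IntegrableOn (fun t : ℝ => Real.exp (-b * t ^ 2)) s :=
  (integrable_exp_neg_mul_sq hb).integrableOn

/-- Since e^u ≥ u⁴/4!, the integrand is at most 24/(b⁴t⁸). The fourth power is the source of (1-β)⁻⁴
in B₃, and η⁻⁷ that of α₀⁻⁷. -/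
theorem integral_exp_neg_mul_sq_Ioi_le {b η : ℝ} (hb : 0 < b) (hη : 0 < η) :
    ∫ t in Ioi η, Real.exp (-b * t ^ 2) ≤ 24 / (7 * b ^ 4 * η ^ 7) := by
  have hi : IntegrableOn (fun t : ℝ => 24 / b ^ 4 * t ^ (-8 : ℝ)) (Ioi η) :=
    (integrableOn_Ioi_rpow_of_lt (by norm_num) hη).const_mul _
  have h := setIntegral_mono_on (integrableOn_exp_neg_mul_sq hb _) hi measurableSet_Ioi
    fun t ht => ?_
  · refine h.trans_eq ?_
    rw [integral_const_mul, integral_Ioi_rpow_of_lt (by norm_num) hη]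
    norm_num
    field_simp
  · have ht0 : 0 < t := hη.trans ht
    have hu : 0 ≤ b * t ^ 2 := by positivity
    have h4 := Real.pow_div_factorial_le_exp _ hu 4
    rw [show (-8 : ℝ) = -((8 : ℕ) : ℝ) by norm_num, Real.rpow_neg ht0.le, Real.rpow_natCast,
      neg_mul, Real.exp_neg, ← div_eq_mul_inv, div_div, ← one_div,
      div_le_div_iff₀ (Real.exp_pos _) (by positivity)]
    norm_num [Nat.factorial] at h4
    nlinarith

/-- The summand P uses only the linear decay, the summand √Q only the Gaussian decay; after
multiplication by √2 each contributes at most 1/(2γ). -/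
theorem endpoint_integral_le {P Q γ : ℝ} (hP : 0 ≤ P) (hQ : 0 < Q) (hγ : 0 < γ) (hγ1 : γ ≤ 1) :
    √2 * (P + √Q) * ∫ t in (0 : ℝ)..1, Real.exp (-(2 * π * (P * t + γ * Q * t ^ 2))) ≤ 1 / γ := by
  have hs2 : 0 < √2 := by positivity
  have hs : √2 * √2 = 2 := Real.mul_self_sqrt (by norm_num)
  have hcont : Continuous fun t : ℝ => Real.exp (-(2 * π * (P * t + γ * Q * t ^ 2))) := by fun_prop
  have hπ := Real.pi_gt_three
  have h1 : P * ∫ t in (0 : ℝ)..1, Real.exp (-(2 * π * (P * t + γ * Q * t ^ 2))) ≤ 1 / (2 * π) := by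
    have hd : ∀ t ∈ uIcc (0 : ℝ) 1, HasDerivAt (fun t => -Real.exp (-(2 * π * P * t)) / (2 * π))
        (P * Real.exp (-(2 * π * P * t))) t := fun t _ => by
      have := (((hasDerivAt_id t).const_mul (2 * π * P)).neg.exp.neg).div_const (2 * π)
      refine this.congr_deriv ?_
      simp only [id, Pi.neg_apply]
      field_simp
    have h := intervalIntegral.integral_eq_sub_of_hasDerivAt hd
      ((by fun_prop : Continuous fun t : ℝ => P * Real.exp (-(2 * π * P * t))).intervalIntegrable _ _)
    rw [← intervalIntegral.integral_const_mul]
    calc _ ≤ ∫ t in (0 : ℝ)..1, P * Real.exp (-(2 * π * P * t)) := by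
          refine intervalIntegral.integral_mono_on zero_le_one
            ((by fun_prop : Continuous fun t : ℝ =>
              P * Real.exp (-(2 * π * (P * t + γ * Q * t ^ 2)))).intervalIntegrable _ _)
            ((by fun_prop : Continuous fun t : ℝ =>
              P * Real.exp (-(2 * π * P * t))).intervalIntegrable _ _) fun t ht => ?_
          have : 0 ≤ 2 * π * (γ * Q * t ^ 2) := by positivity
          exact mul_le_mul_of_nonneg_left (Real.exp_le_exp.2 (by linarith)) hP
      _ ≤ _ := by
          rw [h]
          have : 0 ≤ Real.exp (-(2 * π * P * 1)) / (2 * π) := by positivity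
          simp only [mul_zero, neg_zero, Real.exp_zero, neg_div]
          linarith
  have h2 : ∫ t in (0 : ℝ)..1, Real.exp (-(2 * π * (P * t + γ * Q * t ^ 2)))
      ≤ √(π / (2 * π * γ * Q)) / 2 := by
    have hb : 0 < 2 * π * γ * Q := by positivity
    rw [← integral_exp_neg_mul_sq_Ioi_zero, intervalIntegral.integral_of_le zero_le_one]
    calc _ ≤ ∫ t in Ioc (0 : ℝ) 1, Real.exp (-(2 * π * γ * Q) * t ^ 2) := by
          refine setIntegral_mono_on (hcont.integrableOn_Ioc) (integrableOn_exp_neg_mul_sq hb _)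
            measurableSet_Ioc fun t ht => ?_
          gcongr
          have : 0 ≤ 2 * π * (P * t) := by have := ht.1.le; positivity
          linarith
      _ ≤ _ := setIntegral_mono_set (integrableOn_exp_neg_mul_sq hb _)
          (.of_forall fun t => (Real.exp_pos _).le) (Ioc_subset_Ioi_self.eventuallyLE)
  have h3 : √Q * ∫ t in (0 : ℝ)..1, Real.exp (-(2 * π * (P * t + γ * Q * t ^ 2)))
      ≤ 1 / (2 * √2 * γ) := by
    have hγs : γ ≤ √γ := Real.le_sqrt_of_sq_le (by nlinarith)
    calc _ ≤ √Q * (√(π / (2 * π * γ * Q)) / 2) := by gcongr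
      _ = 1 / (2 * √2 * √γ) := by
        rw [show π / (2 * π * γ * Q) = 1 / (2 * γ * Q) by field_simp, Real.sqrt_div zero_le_one,
          Real.sqrt_one, Real.sqrt_mul (by positivity), Real.sqrt_mul (by positivity)]
        have : 0 < √Q := by positivity
        field_simp
      _ ≤ _ := by gcongr
  -- This holds because γ ≤ 1 and √2 < π.
  have h4 : √2 * (1 / (2 * π)) ≤ 1 / (2 * γ) := by
    rw [mul_one_div, div_le_div_iff₀ (by positivity) (by positivity)]
    nlinarith [mul_nonneg hs2.le (sub_nonneg.2 hγ1)]
  have h5 : √2 * (1 / (2 * √2 * γ)) = 1 / (2 * γ) := by field_simp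
  have h6 : 1 / (2 * γ) + 1 / (2 * γ) = 1 / γ := by field_simp; norm_num
  nlinarith [mul_le_mul_of_nonneg_left h1 hs2.le, mul_le_mul_of_nonneg_left h3 hs2.le]

/-! ### Analysis at the saddle -/

/-- On [0,η] the integrand is replaced by 2p times a Gaussian, which is then completed to the
half-line; [η,α] is estimated absolutely. The polynomial error is integrated over the whole
half-line, whence the exact moments. -/
theorem norm_integral_sub_gaussian_le {H : ℝ → ℂ} {p : ℂ} {K α η b d c₂ c₄ c₆ T : ℝ}
    (hK : 0 ≤ K) (hη : 0 < η) (hηα : η ≤ α) (hb : 0 < b)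
    (hc₂ : 0 ≤ c₂) (hc₄ : 0 ≤ c₄) (hc₆ : 0 ≤ c₆)
    (hH : ContinuousOn H (Icc 0 α)) (hp : ‖p‖ ≤ K)
    (hnear : ∀ s ∈ Icc 0 η, ‖H s - 2 * p * Real.exp (-b * s ^ 2)‖
      ≤ 2 * K * ((c₂ * s ^ 2 + c₄ * s ^ 4 + c₆ * s ^ 6) * Real.exp (-b * s ^ 2)))
    (hfar : ∀ s ∈ Icc η α, ‖H s‖ ≤ 2 * K * Real.exp (-d * s ^ 2))
    (hT : (∫ t in Ioi η, Real.exp (-b * t ^ 2)) + (∫ t in Ioc η α, Real.exp (-d * t ^ 2)) ≤ T) :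
    ‖(∫ s in (0 : ℝ)..α, H s) - p * √(π / b)‖
      ≤ 2 * K * (√(π / b) / 2 * (c₂ * (1 / (2 * b)) + c₄ * (3 / (2 * b) ^ 2)
        + c₆ * (15 / (2 * b) ^ 3)) + T) := by
  have hα : 0 ≤ α := hη.le.trans hηα
  have hI : ∀ {u v : ℝ}, 0 ≤ u → u ≤ v → v ≤ α → IntervalIntegrable H volume u v :=
    fun hu huv hv => ContinuousOn.intervalIntegrable
      (hH.mono (by rw [uIcc_of_le huv]; exact Icc_subset_Icc hu hv))
  have hE : Integrable fun t : ℝ => Real.exp (-b * t ^ 2) := integrable_exp_neg_mul_sq hb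
  have hEc : Continuous fun t : ℝ => (Real.exp (-b * t ^ 2) : ℂ) := by fun_prop
  have hsplit : ((√(π / b) / 2 : ℝ) : ℂ) = (∫ t in (0 : ℝ)..η, (Real.exp (-b * t ^ 2) : ℂ))
      + ((∫ t in Ioi η, Real.exp (-b * t ^ 2) : ℝ) : ℂ) := by
    rw [intervalIntegral.integral_of_le hη.le, integral_complex_ofReal, ← Complex.ofReal_add,
      ← setIntegral_union (Ioc_disjoint_Ioi le_rfl) measurableSet_Ioi hE.integrableOn
        hE.integrableOn, Ioc_union_Ioi_eq_Ioi hη.le, integral_exp_neg_mul_sq_Ioi_zero]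
  have hdecomp : (∫ s in (0 : ℝ)..α, H s) - p * √(π / b)
      = (∫ s in (0 : ℝ)..η, (H s - 2 * p * Real.exp (-b * s ^ 2))) + (∫ s in η..α, H s)
        - 2 * p * ((∫ t in Ioi η, Real.exp (-b * t ^ 2) : ℝ) : ℂ) := by
    rw [intervalIntegral.integral_sub (hI le_rfl hη.le hηα)
      ((by fun_prop : Continuous fun s : ℝ =>
        2 * p * (Real.exp (-b * s ^ 2) : ℂ)).intervalIntegrable _ _), intervalIntegral.integral_const_mul,
      ← intervalIntegral.integral_add_adjacent_intervals (hI le_rfl hη.le hηα)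
        (hI hη.le hηα le_rfl)]
    push_cast at hsplit ⊢
    linear_combination (-2 * p) * hsplit
  have hPi : IntegrableOn (fun s : ℝ => (c₂ * s ^ 2 + c₄ * s ^ 4 + c₆ * s ^ 6)
      * Real.exp (-b * s ^ 2)) (Ioi 0) := by
    have := (((integrableOn_pow_mul_exp_neg_mul_sq hb 2).const_mul c₂).add
      ((integrableOn_pow_mul_exp_neg_mul_sq hb 4).const_mul c₄)).add
      ((integrableOn_pow_mul_exp_neg_mul_sq hb 6).const_mul c₆)
    refine IntegrableOn.congr_fun this (fun s _ => ?_) measurableSet_Ioi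
    simp only [Pi.add_apply]
    ring
  have hPv : ∫ s in Ioi (0 : ℝ), (c₂ * s ^ 2 + c₄ * s ^ 4 + c₆ * s ^ 6) * Real.exp (-b * s ^ 2)
      = √(π / b) / 2 * (c₂ * (1 / (2 * b)) + c₄ * (3 / (2 * b) ^ 2) + c₆ * (15 / (2 * b) ^ 3)) := by
    have h2 := (integrableOn_pow_mul_exp_neg_mul_sq hb 2).const_mul c₂
    have h4 := (integrableOn_pow_mul_exp_neg_mul_sq hb 4).const_mul c₄
    have h6 := (integrableOn_pow_mul_exp_neg_mul_sq hb 6).const_mul c₆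
    have h24 : IntegrableOn (fun s : ℝ => c₂ * (s ^ 2 * Real.exp (-b * s ^ 2))
      + c₄ * (s ^ 4 * Real.exp (-b * s ^ 2))) (Ioi 0) := h2.add h4
    calc _ = ∫ s in Ioi (0 : ℝ), ((c₂ * (s ^ 2 * Real.exp (-b * s ^ 2))
          + c₄ * (s ^ 4 * Real.exp (-b * s ^ 2))) + c₆ * (s ^ 6 * Real.exp (-b * s ^ 2))) := by
          congr 1; ext s; ring
      _ = _ := by
          rw [integral_add h24 h6, integral_add h2 h4, integral_const_mul,
            integral_const_mul, integral_const_mul, integral_sq_mul_exp_neg_mul_sq hb,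
            integral_pow_four_mul_exp_neg_mul_sq hb, integral_pow_six_mul_exp_neg_mul_sq hb]
          ring
  have b1 : ‖∫ s in (0 : ℝ)..η, (H s - 2 * p * Real.exp (-b * s ^ 2))‖
      ≤ 2 * K * (√(π / b) / 2 * (c₂ * (1 / (2 * b)) + c₄ * (3 / (2 * b) ^ 2)
        + c₆ * (15 / (2 * b) ^ 3))) := by
    rw [← hPv, ← integral_const_mul]
    calc _ ≤ ∫ s in (0 : ℝ)..η, 2 * K * ((c₂ * s ^ 2 + c₄ * s ^ 4 + c₆ * s ^ 6)
            * Real.exp (-b * s ^ 2)) :=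
          intervalIntegral.norm_integral_le_of_norm_le hη.le
            (.of_forall fun s hs => hnear s (Ioc_subset_Icc_self hs))
            (Continuous.intervalIntegrable (by fun_prop) _ _)
      _ ≤ _ := by
          rw [intervalIntegral.integral_of_le hη.le]
          refine setIntegral_mono_set (hPi.const_mul _) (.of_forall fun t => ?_)
            Ioc_subset_Ioi_self.eventuallyLE
          dsimp only [Pi.zero_apply]
          positivity
  have b2 : ‖∫ s in η..α, H s‖ ≤ 2 * K * ∫ t in Ioc η α, Real.exp (-d * t ^ 2) := by
    rw [← intervalIntegral.integral_of_le hηα, ← intervalIntegral.integral_const_mul]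
    exact intervalIntegral.norm_integral_le_of_norm_le hηα
      (.of_forall fun s hs => hfar s (Ioc_subset_Icc_self hs))
      (Continuous.intervalIntegrable (by fun_prop) _ _)
  have b3 : ‖2 * p * ((∫ t in Ioi η, Real.exp (-b * t ^ 2) : ℝ) : ℂ)‖
      ≤ 2 * K * ∫ t in Ioi η, Real.exp (-b * t ^ 2) := by
    have h0 : 0 ≤ ∫ t in Ioi η, Real.exp (-b * t ^ 2) :=
      integral_nonneg fun t => (Real.exp_pos _).le
    rw [norm_mul, norm_mul, Complex.norm_real, Real.norm_eq_abs, abs_of_nonneg h0,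
      Complex.norm_ofNat]
    gcongr
  rw [hdecomp]
  calc _ ≤ _ := (norm_sub_le _ _).trans (add_le_add_left (norm_add_le _ _) _)
    _ ≤ _ := by nlinarith [mul_le_mul_of_nonneg_left hT (by positivity : 0 ≤ 2 * K)]

/-- The cubic remainder is of order F·s³. One factor s is traded for α and F for A₃Q, where Q = r²q;
this is what defines β. -/
theorem norm_phase_sub_quadratic_le {f : ℂ → ℂ} {x : ℂ} {r q A₂ A₃ F α : ℝ} (hr : 0 < r)
    (hF : 0 < F) (hA₂ : 0 < A₂) (hA₃ : 0 < A₃) (hα : 0 < α) (hα1 : α * √2 < 1)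
    (hf : AnalyticOnNhd ℂ f (Metric.closedBall x r))
    (hf1 : ∀ z ∈ Metric.closedBall x r, ‖deriv f z‖ ≤ A₂ * (F / r))
    (hq : deriv (deriv f) x = q) (hqF : F ≤ A₃ * (r ^ 2 * q)) {z : ℂ} {s : ℝ}
    (hsα : s ≤ α) (hz : ‖z‖ = √2 * s) :
    ‖f (x + r * z) - (f x + deriv f x * (r * z) + q * r ^ 2 / 2 * z ^ 2)‖
      ≤ beta A₂ A₃ α * (r ^ 2 * q) * s ^ 2 := by
  have hs2 : √2 ^ 2 = 2 := Real.sq_sqrt (by norm_num)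
  have h2 : 0 < √2 := by positivity
  have hz1 : ‖z‖ ≤ α * √2 := by rw [hz, mul_comm]; gcongr
  have h := norm_sub_taylor_le_of_norm_deriv_le hr hf hf1 (m := 3) (by norm_num)
    (hz1.trans_lt hα1)
  simp only [Finset.sum_range_succ, Finset.sum_range_zero, iteratedDeriv_succ', iteratedDeriv_zero,
    hq, Nat.factorial] at h
  have e : f (x + r * z) - (f x + deriv f x * (r * z) + q * r ^ 2 / 2 * z ^ 2)
    = f (x + r * z) - (0 + f x * r ^ 0 / (1 : ℕ) * z ^ 0
      + deriv f x * r ^ 1 / ((0 + 1) * 1 : ℕ) * z ^ 1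
      + q * r ^ 2 / ((1 + 1) * ((0 + 1) * 1) : ℕ) * z ^ 2) := by
    push_cast
    ring
  rw [e]
  refine h.trans ?_
  have hD : 0 < 1 - α * √2 := by linarith
  have hAQ : 0 < A₃ * (r ^ 2 * q) := hF.trans_le hqF
  have hcube : ‖z‖ ^ 3 ≤ 2 * √2 * α * s ^ 2 := by
    rw [hz, mul_pow, show √2 ^ 3 = 2 * √2 by rw [pow_succ, hs2]]
    have : s ^ 3 ≤ α * s ^ 2 := by rw [pow_succ']; gcongr
    nlinarith
  calc r * (A₂ * (F / r)) / (3 : ℕ) * ‖z‖ ^ 3 / (1 - ‖z‖)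
      = A₂ * F / 3 * ‖z‖ ^ 3 / (1 - ‖z‖) := by push_cast; field_simp
    _ ≤ A₂ * (A₃ * (r ^ 2 * q)) / 3 * (2 * √2 * α * s ^ 2) / (1 - α * √2) := by gcongr
    _ = beta A₂ A₃ α * (r ^ 2 * q) * s ^ 2 := by
      rw [beta]; field_simp

/-- The closed form of ω₂ hides a half square: it is the constant of the bound w²/2·e^{|w|} for the
second-order remainder of exp. -/
theorem omega2_eq {A₂ α : ℝ} (hα1 : α * √2 < 1) :
    omega2 A₂ α = Real.exp (omega1 A₂ α)
      * ((2 * π * A₂ * (2 * √2 / 3 + α / (1 - α * √2))) ^ 2 / 2) := by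
  have hs2 : √2 ^ 2 = 2 := Real.sq_sqrt (by norm_num)
  have h2 : 0 < √2 := by positivity
  have hD : 1 - α * √2 ≠ 0 := by linarith
  rw [omega2, mul_assoc]
  congr 1
  have : √2 - 2 * α = √2 * (1 - α * √2) := by linear_combination α * hs2
  rw [this]
  have e1 : 3 * α / (√2 * (1 - α * √2)) = 3 * √2 / 2 * (α / (1 - α * √2)) := by
    field_simp
    linear_combination -α * hs2
  have e2 : 3 * √2 * α / (8 * (1 - α * √2)) = 3 * √2 / 8 * (α / (1 - α * √2)) := by field_simp
  rw [e1, e2]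
  generalize α / (1 - α * √2) = x
  linear_combination (2 * π ^ 2 * A₂ ^ 2 * (x ^ 2 / 2 - 4 / 9)) * hs2

/-- The restriction on Fs³ keeps 2π‖θ‖ below ω₁, so the exponential in the remainder is bounded
uniformly. -/
theorem phase_exp_bounds {A₂ F α s : ℝ} {θ : ℂ} (hA₂ : 0 < A₂) (hF : 0 < F) (hα : 0 < α)
    (hα1 : α * √2 ≤ 3 / 5) (hs : 0 ≤ s) (hsα : s ≤ α) (hFs : F * s ^ 3 ≤ 27 / 125 * α ^ 3)
    (hθ : ‖θ‖ ≤ A₂ * F * (2 * √2 / 3 * s ^ 3 + s ^ 4 / (1 - α * √2))) :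
    ‖Complex.exp (2 * π * Complex.I * θ) - 1 - 2 * π * Complex.I * θ‖
        ≤ omega2 A₂ α * F ^ 2 * s ^ 6 ∧
      ‖Complex.exp (2 * π * Complex.I * θ) - 1‖ ≤ omega3 A₂ α * F * s ^ 3 := by
  have hs2 : √2 ^ 2 = 2 := Real.sq_sqrt (by norm_num)
  have h2 : 0 < √2 := by positivity
  have h2l : 1.4 < √2 := Real.lt_sqrt_of_sq_lt (by norm_num)
  have hD : 2 / 5 ≤ 1 - α * √2 := by linarith
  have hD0 : 0 < 1 - α * √2 := by linarith
  set x := α / (1 - α * √2) with hx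
  have hx0 : 0 < x := by positivity
  have hx1 : x ≤ 1.1 := by
    rw [hx, div_le_iff₀ hD0]
    nlinarith
  have hw : ‖2 * π * Complex.I * θ‖ = 2 * π * ‖θ‖ := by
    simp [abs_of_pos Real.pi_pos]
  have hθ' : 2 * π * ‖θ‖ ≤ 2 * π * A₂ * (2 * √2 / 3 + x) * (F * s ^ 3) := by
    have : s ^ 4 / (1 - α * √2) ≤ x * s ^ 3 := by
      rw [hx, pow_succ, mul_div_assoc, mul_comm]
      gcongr
    calc _ ≤ 2 * π * (A₂ * F * (2 * √2 / 3 * s ^ 3 + x * s ^ 3)) := by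
          refine mul_le_mul_of_nonneg_left (hθ.trans ?_) (by positivity)
          gcongr
      _ = _ := by ring
  have hω1 : 2 * π * ‖θ‖ ≤ omega1 A₂ α := by
    refine hθ'.trans ?_
    calc _ ≤ 2 * π * A₂ * (2 * √2 / 3 + x) * (27 / 125 * α ^ 3) := by gcongr
      _ = π * α ^ 3 * A₂ * (54 / 125 * (2 * √2 / 3 + x)) := by ring
      -- Here 54/125 exceeds the coefficient 27/2⁷ of x, but x ≤ 1.1 and the slack in the √2 term
      -- absorbs the difference.
      _ ≤ π * α ^ 3 * A₂ * (4 * √2 / 3 + 27 / 2 ^ 7 * x) := by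
          gcongr
          nlinarith
      _ = omega1 A₂ α := by rw [omega1, hx]; field_simp
  have hE : ‖Complex.exp (2 * π * Complex.I * θ) - 1 - 2 * π * Complex.I * θ‖
      ≤ omega2 A₂ α * F ^ 2 * s ^ 6 := by
    refine (norm_exp_sub_one_sub_id_le_half _).trans ?_
    rw [hw, omega2_eq (by linarith), ← hx]
    calc _ ≤ (2 * π * A₂ * (2 * √2 / 3 + x) * (F * s ^ 3)) ^ 2 / 2
          * Real.exp (omega1 A₂ α) := by gcongr
      _ = _ := by ring
  refine ⟨hE, ?_⟩
  have hω2 : 0 ≤ omega2 A₂ α := by rw [omega2_eq (by linarith)]; positivity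
  calc ‖Complex.exp (2 * π * Complex.I * θ) - 1‖
      = ‖(Complex.exp (2 * π * Complex.I * θ) - 1 - 2 * π * Complex.I * θ)
        + 2 * π * Complex.I * θ‖ := by rw [sub_add_cancel]
    _ ≤ omega2 A₂ α * F ^ 2 * s ^ 6 + 2 * π * A₂ * (2 * √2 / 3 + x) * (F * s ^ 3) :=
        (norm_add_le _ _).trans (add_le_add hE (hw.trans_le hθ'))
    _ = (omega2 A₂ α * (F * s ^ 3) + 2 * π * A₂ * (2 * √2 / 3 + x)) * (F * s ^ 3) := by ring
    _ ≤ (omega2 A₂ α * α ^ 3 + 2 * π * A₂ * (2 * √2 / 3 + x)) * (F * s ^ 3) := by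
        have : F * s ^ 3 ≤ α ^ 3 := hFs.trans (by nlinarith [pow_pos hα 3])
        gcongr
    _ = omega3 A₂ α * F * s ^ 3 := by rw [omega3, hx]; ring

theorem norm_symmetrized_sub_le {A₂ F K α s : ℝ} {z p₀ p₁ ρ ρ' c τ τ' θ θ' : ℂ} (hA₂ : 0 < A₂)
    (hF : 0 < F) (hK : 0 ≤ K) (hα : 0 < α) (hα1 : α * √2 ≤ 3 / 5) (hs : 0 ≤ s) (hsα : s ≤ α)
    (hFs : F * s ^ 3 ≤ 27 / 125 * α ^ 3) (hz : ‖z‖ = √2 * s) (hp₀ : ‖p₀‖ ≤ K) (hp₁ : ‖p₁‖ ≤ K)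
    (hc : ‖c‖ ≤ A₂ * F / 3) (hρ : ‖ρ‖ ≤ K * (2 * s ^ 2 / (1 - α * √2)))
    (hρ' : ‖ρ'‖ ≤ K * (2 * s ^ 2 / (1 - α * √2)))
    (hτ : ‖τ‖ ≤ A₂ * F * s ^ 4 / (1 - α * √2)) (hτ' : ‖τ'‖ ≤ A₂ * F * s ^ 4 / (1 - α * √2))
    (hθ : θ = c * z ^ 3 + τ) (hθ' : θ' = c * (-z) ^ 3 + τ') :
    ‖(p₀ + p₁ * z + ρ) * Complex.exp (2 * π * Complex.I * θ)
        + (p₀ + p₁ * (-z) + ρ') * Complex.exp (2 * π * Complex.I * θ') - 2 * p₀‖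
      ≤ 2 * K * (2 * (1 + α ^ 3 * omega3 A₂ α) / (1 - α * √2) * s ^ 2
        + F * (2 * π * A₂ / (1 - α * √2) + omega3 A₂ α * √2) * s ^ 4
        + omega2 A₂ α * F ^ 2 * s ^ 6) := by
  have hs2 : √2 ^ 2 = 2 := Real.sq_sqrt (by norm_num)
  have hD0 : 0 < 1 - α * √2 := by linarith
  have hcz : ‖c‖ * ‖z‖ ^ 3 ≤ A₂ * F * (2 * √2 / 3 * s ^ 3) := by
    calc _ ≤ A₂ * F / 3 * (√2 * s) ^ 3 := by rw [hz]; gcongr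
      _ = _ := by linear_combination A₂ * F / 3 * s ^ 3 * √2 * hs2
  have hθn : ‖θ‖ ≤ A₂ * F * (2 * √2 / 3 * s ^ 3 + s ^ 4 / (1 - α * √2)) := by
    rw [hθ, mul_add, ← mul_div_assoc]
    refine (norm_add_le _ _).trans (add_le_add ?_ hτ)
    rwa [norm_mul, norm_pow]
  have hθn' : ‖θ'‖ ≤ A₂ * F * (2 * √2 / 3 * s ^ 3 + s ^ 4 / (1 - α * √2)) := by
    rw [hθ', mul_add, ← mul_div_assoc]
    refine (norm_add_le _ _).trans (add_le_add ?_ hτ')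
    rwa [norm_mul, norm_pow, norm_neg]
  obtain ⟨hE, hu⟩ := phase_exp_bounds hA₂ hF hα hα1 hs hsα hFs hθn
  obtain ⟨hE', hu'⟩ := phase_exp_bounds hA₂ hF hα hα1 hs hsα hFs hθn'
  set u := Complex.exp (2 * π * Complex.I * θ)
  set u' := Complex.exp (2 * π * Complex.I * θ')
  set ω₂ := omega2 A₂ α
  have hω3 : 0 ≤ omega3 A₂ α := by
    have : 0 ≤ omega2 A₂ α := by rw [omega2_eq (by linarith)]; positivity
    rw [omega3]; positivity
  set ω₃ := omega3 A₂ α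
  have hFs' : F * s ^ 3 ≤ α ^ 3 := hFs.trans (by nlinarith [pow_pos hα 3])
  have hun : ∀ v : ℂ, ‖v - 1‖ ≤ ω₃ * F * s ^ 3 → ‖v‖ ≤ 1 + α ^ 3 * ω₃ := fun v hv => by
    calc ‖v‖ = ‖1 + (v - 1)‖ := by congr 1; ring
      _ ≤ 1 + ω₃ * F * s ^ 3 := (norm_add_le _ _).trans (by rw [norm_one]; gcongr)
      _ ≤ _ := by nlinarith
  have hpi : ∀ v : ℂ, ‖2 * π * Complex.I * v‖ = 2 * π * ‖v‖ := fun v => by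
    simp [abs_of_pos Real.pi_pos]
  -- The term cz³ has opposite values at z and -z, so the first-order parts of the exponentials
  -- leave only τ and τ'. The odd term p₁z meets the difference of two factors close to 1, which
  -- gains Fs³.
  have key : (p₀ + p₁ * z + ρ) * u + (p₀ + p₁ * (-z) + ρ') * u' - 2 * p₀
      = p₀ * ((u - 1 - 2 * π * Complex.I * θ) + (u' - 1 - 2 * π * Complex.I * θ')
        + (2 * π * Complex.I * τ + 2 * π * Complex.I * τ'))
        + p₁ * z * ((u - 1) - (u' - 1)) + (ρ * u + ρ' * u') := by
    rw [hθ, hθ']; ring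
  rw [key]
  have t1 : ‖p₀ * ((u - 1 - 2 * π * Complex.I * θ) + (u' - 1 - 2 * π * Complex.I * θ')
        + (2 * π * Complex.I * τ + 2 * π * Complex.I * τ'))‖
      ≤ K * ((ω₂ * F ^ 2 * s ^ 6 + ω₂ * F ^ 2 * s ^ 6)
        + (2 * π * (A₂ * F * s ^ 4 / (1 - α * √2)) + 2 * π * (A₂ * F * s ^ 4 / (1 - α * √2)))) := by
    rw [norm_mul]
    refine mul_le_mul hp₀ ?_ (norm_nonneg _) hK
    refine (norm_add_le _ _).trans (add_le_add ((norm_add_le _ _).trans (add_le_add hE hE'))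
      ((norm_add_le _ _).trans (add_le_add ?_ ?_))) <;> rw [hpi] <;> gcongr
  have t2 : ‖p₁ * z * ((u - 1) - (u' - 1))‖
      ≤ K * (√2 * s) * (ω₃ * F * s ^ 3 + ω₃ * F * s ^ 3) := by
    rw [norm_mul, norm_mul, hz]
    gcongr
    exact (norm_sub_le _ _).trans (add_le_add hu hu')
  have t3 : ‖ρ * u + ρ' * u'‖ ≤ K * (2 * s ^ 2 / (1 - α * √2)) * (1 + α ^ 3 * ω₃)
      + K * (2 * s ^ 2 / (1 - α * √2)) * (1 + α ^ 3 * ω₃) := by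
    refine (norm_add_le _ _).trans (add_le_add ?_ ?_) <;> rw [norm_mul]
    · exact mul_le_mul hρ (hun u hu) (norm_nonneg _) (by positivity)
    · exact mul_le_mul hρ' (hun u' hu') (norm_nonneg _) (by positivity)
  refine ((norm_add_le _ _).trans (add_le_add ((norm_add_le _ _).trans (add_le_add t1 t2))
    t3)).trans_eq ?_
  field_simp
  ring

/-- Chooses the splitting point η: small enough for the expansion (Fη³ ≤ 27α³/125), large enough for
the tails to be O(F^{-3/2}). -/
theorem gaussian_tails_le {A₂ A₃ F Q α : ℝ} (hA₃ : 0 < A₃) (hF : 0 < F) (hα : 0 < α)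
    (hQ : F ≤ A₃ * Q) (hγ : 0 < 1 - beta A₂ A₃ α) (hγ1 : 1 - beta A₂ A₃ α ≤ 1)
    (hα6 : π ^ 3 * α ^ 6 ≤ 48 * A₃ ^ 3) :
    ∃ η, 0 < η ∧ η ≤ α ∧ F * η ^ 3 ≤ 27 / 125 * α ^ 3 ∧
      2 * √2 * ((∫ t in Ioi η, Real.exp (-(2 * π * Q) * t ^ 2))
        + ∫ t in Ioc η α, Real.exp (-(2 * π * (1 - beta A₂ A₃ α) * Q) * t ^ 2))
      ≤ A₃ ^ 4 * B3 A₂ A₃ α * F ^ (-(3 / 2) : ℝ) := by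
  have h2 : 0 < √2 := by positivity
  have hπ := Real.pi_pos
  rw [B3]
  set γ := 1 - beta A₂ A₃ α
  have hQ0 : 0 < Q := pos_of_mul_pos_right (hF.trans_le hQ) hA₃.le
  -- With w = F^{1/6}, all fractional powers of F become integral powers of w.
  obtain ⟨w, hw, hwF⟩ : ∃ w : ℝ, 0 < w ∧ w ^ 6 = F :=
    ⟨F ^ (1 / 6 : ℝ), by positivity, by
      rw [← Real.rpow_natCast, ← Real.rpow_mul hF.le]; norm_num⟩
  have hFw : F ^ (-(3 / 2) : ℝ) = (w ^ 9)⁻¹ := by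
    rw [← hwF, ← Real.rpow_natCast w 6, ← Real.rpow_mul hw.le, ← Real.rpow_natCast w 9,
      ← Real.rpow_neg hw.le]
    norm_num
  rw [hFw]
  -- 27/125 = (3/5)³ is the value of F at which 3α/(5F^{1/3}) equals α.
  rcases le_total (27 / 125) F with hF1 | hF1
  · have hw2 : 3 / 5 ≤ w ^ 2 := by
      by_contra! hlt
      have : (w ^ 2) ^ 3 < (3 / 5) ^ 3 := by gcongr
      nlinarith
    have hwl : 1 / 2 ≤ w := by nlinarith
    set η := 3 / 5 * α / w ^ 2 with hη
    have hη0 : 0 < η := by positivity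
    have hηα : η ≤ α := by
      rw [hη, div_le_iff₀ (by positivity)]
      nlinarith
    refine ⟨η, hη0, hηα, le_of_eq ?_, ?_⟩
    · rw [hη, ← hwF]; field_simp; norm_num
    -- Used with g = 1 and g = γ, for the two summands of B₃. The surplus factor is a constant times
    -- 1/w, harmless as w ≥ 1/2.
    · have tail : ∀ g : ℝ, 0 < g → 2 * √2 * ∫ t in Ioi η, Real.exp (-(2 * π * g * Q) * t ^ 2)
          ≤ A₃ ^ 4 * (48 * √2 / (π ^ 4 * α ^ 7) * (g ^ 4)⁻¹) * (w ^ 9)⁻¹ := fun g hg => by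
        have hb : 0 < 2 * π * g * Q := by positivity
        have hlow : 2 * π * g * w ^ 6 / A₃ ≤ 2 * π * g * Q := by
          rw [div_le_iff₀ hA₃, hwF, mul_assoc (2 * π * g), mul_comm Q]
          gcongr
        calc _ ≤ 2 * √2 * (24 / (7 * (2 * π * g * Q) ^ 4 * η ^ 7)) := by
              gcongr; exact integral_exp_neg_mul_sq_Ioi_le hb hη0
          _ ≤ 2 * √2 * (24 / (7 * (2 * π * g * w ^ 6 / A₃) ^ 4 * η ^ 7)) := by gcongr
          _ = A₃ ^ 4 * (48 * √2 / (π ^ 4 * α ^ 7) * (g ^ 4)⁻¹) * (w ^ 9)⁻¹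
              * (1 / 112 * (5 / 3) ^ 7 / w) := by
              rw [hη]; field_simp; norm_num
          _ ≤ _ := by
              refine mul_le_of_le_one_right (by positivity) ?_
              rw [div_le_one hw]
              linarith
      have t1 := tail 1 one_pos
      have t2 := tail γ hγ
      have t3 : ∫ t in Ioc η α, Real.exp (-(2 * π * γ * Q) * t ^ 2)
          ≤ ∫ t in Ioi η, Real.exp (-(2 * π * γ * Q) * t ^ 2) :=
        setIntegral_mono_set (integrableOn_exp_neg_mul_sq (by positivity) _)
          (.of_forall fun t => (Real.exp_pos _).le) (Ioc_subset_Ioi_self.eventuallyLE)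
      rw [mul_one, one_pow, inv_one, mul_one] at t1
      have t4 := mul_le_mul_of_nonneg_left t3 (by positivity : 0 ≤ 2 * √2)
      rw [mul_add]
      calc _ ≤ _ := add_le_add t1 (t4.trans t2)
        _ = _ := by ring
  -- For small F the expansion is valid up to α and no far range remains; the completed tail is
  -- bounded by the full half-line Gaussian.
  · refine ⟨α, hα, le_rfl, by gcongr, ?_⟩
    have hb : 0 < 2 * π * Q := by positivity
    rw [Ioc_self, setIntegral_empty, add_zero]
    obtain ⟨a, ha, haA⟩ : ∃ a : ℝ, 0 < a ∧ a ^ 2 = A₃ := ⟨√A₃, by positivity, Real.sq_sqrt hA₃.le⟩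
    -- Needed for the seventh factor α in π⁴α⁷, beyond the six covered by `hα6`.
    have hαa : α ≤ √2 * a := by
      by_contra! hlt
      have h6 : (√2 * a) ^ 6 < α ^ 6 := by gcongr
      have e6 : (√2 * a) ^ 6 = 8 * A₃ ^ 3 := by
        rw [mul_pow, ← haA, show √2 ^ 6 = (√2 ^ 2) ^ 3 by ring, Real.sq_sqrt (by norm_num)]
        ring
      have hπ3 : (3 : ℝ) ^ 3 ≤ π ^ 3 := by gcongr; exact Real.pi_gt_three.le
      nlinarith [pow_pos hα 6, pow_pos hA₃ 3]
    have hQs : w ^ 3 / a ≤ √Q := by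
      refine Real.le_sqrt_of_sq_le ?_
      rw [div_pow, haA, div_le_iff₀ hA₃, mul_comm Q]
      calc _ = F := by rw [← hwF]; ring
        _ ≤ _ := hQ
    calc _ ≤ 2 * √2 * ∫ t in Ioi (0 : ℝ), Real.exp (-(2 * π * Q) * t ^ 2) := by
          gcongr ?_ * ?_
          exact setIntegral_mono_set (integrableOn_exp_neg_mul_sq hb _)
            (.of_forall fun t => (Real.exp_pos _).le) (Ioi_subset_Ioi hα.le).eventuallyLE
      _ = 1 / √Q := by
          rw [integral_exp_neg_mul_sq_Ioi_zero, show π / (2 * π * Q) = 1 / (2 * Q) by field_simp,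
            Real.sqrt_div zero_le_one, Real.sqrt_one, Real.sqrt_mul (by positivity)]
          field_simp
      _ ≤ 1 / (w ^ 3 / a) := by gcongr
      _ ≤ A₃ ^ 4 * (48 * √2 / (π ^ 4 * α ^ 7) * (1 + 1)) * (w ^ 9)⁻¹ := by
          rw [← div_eq_mul_inv, one_div_div, div_le_div_iff₀ (by positivity) (by positivity),
            ← mul_div_right_comm, mul_div_assoc', div_mul_eq_mul_div, le_div_iff₀ (by positivity)]
          have h1 : π ^ 4 * α ^ 7 ≤ π * (√2 * a) * (48 * A₃ ^ 3) := by
            calc _ = π * α * (π ^ 3 * α ^ 6) := by ring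
              _ ≤ _ := by gcongr
          have hπ4 : π ≤ 4 := Real.pi_le_four
          calc a * w ^ 9 * (π ^ 4 * α ^ 7)
              ≤ a * w ^ 9 * (π * (√2 * a) * (48 * A₃ ^ 3)) := by gcongr
            _ = w ^ 6 * π * (48 * √2 * A₃ ^ 4 * w ^ 3) := by rw [← haA]; ring
            _ ≤ (27 / 125) * 4 * (48 * √2 * A₃ ^ 4 * w ^ 3) := by
                rw [hwF]; gcongr
            _ ≤ 2 * (48 * √2 * A₃ ^ 4 * w ^ 3) := by gcongr; norm_num
            _ = _ := by ring
      _ ≤ _ := by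
          gcongr
          exact (one_le_inv₀ (by positivity)).2 (pow_le_one₀ hγ.le hγ1)

/-- The left side decreases in Q; at the least admissible value Q = F/A₃ it equals the right side,
which explains the form of B₄. -/
theorem gaussian_moments_le {A₂ A₃ F Q α : ℝ} (hA₂ : 0 < A₂) (hA₃ : 0 < A₃) (hF : 0 < F)
    (hα : 0 < α) (hα1 : α * √2 < 1) (hQ : F ≤ A₃ * Q) :
    2 * √2 * (√(π / (2 * π * Q)) / 2
      * (2 * (1 + α ^ 3 * omega3 A₂ α) / (1 - α * √2) * (1 / (2 * (2 * π * Q)))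
        + F * (2 * π * A₂ / (1 - α * √2) + omega3 A₂ α * √2) * (3 / (2 * (2 * π * Q)) ^ 2)
        + omega2 A₂ α * F ^ 2 * (15 / (2 * (2 * π * Q)) ^ 3)))
      ≤ √A₃ * B4 A₂ A₃ α * F ^ (-(3 / 2) : ℝ) := by
  have hQ0 : 0 < Q := pos_of_mul_pos_right (hF.trans_le hQ) hA₃.le
  have hD : 0 < 1 - α * √2 := by linarith
  have hω2 : 0 ≤ omega2 A₂ α := by rw [omega2_eq hα1]; positivity
  have hω3 : 0 ≤ omega3 A₂ α := by rw [omega3]; positivity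
  have hF32 : F ^ (-(3 / 2) : ℝ) = (√F * F)⁻¹ := by
    rw [Real.rpow_neg hF.le, show (3 / 2 : ℝ) = 1 / 2 + 1 by norm_num, Real.rpow_add hF,
      ← Real.sqrt_eq_rpow, Real.rpow_one]
  have hlow : F / A₃ ≤ Q := by rwa [div_le_iff₀' hA₃]
  rw [B4, hF32]
  calc _ ≤ 2 * √2 * (√(π / (2 * π * (F / A₃))) / 2
      * (2 * (1 + α ^ 3 * omega3 A₂ α) / (1 - α * √2) * (1 / (2 * (2 * π * (F / A₃))))
        + F * (2 * π * A₂ / (1 - α * √2) + omega3 A₂ α * √2) * (3 / (2 * (2 * π * (F / A₃))) ^ 2)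
        + omega2 A₂ α * F ^ 2 * (15 / (2 * (2 * π * (F / A₃))) ^ 3))) := by gcongr
    _ = _ := by
      have : √(π / (2 * π * (F / A₃))) = √A₃ / (√2 * √F) := by
        rw [show π / (2 * π * (F / A₃)) = A₃ / (2 * F) by field_simp, Real.sqrt_div hA₃.le,
          Real.sqrt_mul (by positivity)]
      rw [this]
      have : 0 < √F := by positivity
      field_simp
      ring

/-- The 1/8 in the main term is the argument of the direction 1+i: e^{2πi/8} = (1+i)/√2. -/
theorem mainTerm_eq {f φ : ℂ → ℂ} {x₀ k r q : ℝ} (hr : 0 < r) (hq0 : 0 < q)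
    (hq : deriv (deriv f) x₀ = q) :
    mainTerm k x₀ φ f = (1 + Complex.I) * r * (Complex.exp (2 * π * Complex.I * (f x₀ + k * x₀))
      * (φ x₀ * √(π / (2 * π * (r ^ 2 * q))))) := by
  have h8 : Complex.exp (2 * π * Complex.I * (1 / 8)) = (1 + Complex.I) / √2 := by
    rw [show 2 * π * Complex.I * (1 / 8) = ((π / 4 : ℝ) : ℂ) * Complex.I by push_cast; ring,
      Complex.exp_mul_I, ← Complex.ofReal_cos, ← Complex.ofReal_sin, Real.cos_pi_div_four,
      Real.sin_pi_div_four]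
    have h2 : ((√2 : ℝ) : ℂ) ^ 2 = 2 := by
      rw [← Complex.ofReal_pow, Real.sq_sqrt (by norm_num)]; norm_num
    have h0 : ((√2 : ℝ) : ℂ) ≠ 0 := by
      rw [Complex.ofReal_ne_zero]; positivity
    push_cast
    field_simp
    linear_combination (1 + Complex.I) * h2
  have hs : √(π / (2 * π * (r ^ 2 * q))) = 1 / (√2 * (r * √q)) := by
    rw [show π / (2 * π * (r ^ 2 * q)) = 1 / (2 * (r ^ 2 * q)) by field_simp,
      Real.sqrt_div zero_le_one, Real.sqrt_one, Real.sqrt_mul (by positivity),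
      Real.sqrt_mul (by positivity), Real.sqrt_sq hr.le]
  have hr' : (r : ℂ) ≠ 0 := by exact_mod_cast hr.ne'
  have hq' : ((√q : ℝ) : ℂ) ≠ 0 := by
    rw [Complex.ofReal_ne_zero]; positivity
  have h20 : ((√2 : ℝ) : ℂ) ≠ 0 := by
    rw [Complex.ofReal_ne_zero]; positivity
  rw [mainTerm, hq, Complex.ofReal_re, mul_add (2 * (π : ℂ) * Complex.I) (f x₀ + k * x₀),
    Complex.exp_add, h8, hs]
  push_cast
  field_simp

theorem norm_saddle_integral_sub_mainTerm_le {f φ : ℂ → ℂ} {x₀ k r q A₁ A₂ A₃ F Φ α : ℝ}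
    (hr : 0 < r) (hF : 0 < F) (hA₁ : 0 < A₁) (hΦ : 0 < Φ) (hA₂ : 0 < A₂) (hA₃ : 0 < A₃) (hα : 0 < α)
    (hf : AnalyticOnNhd ℂ f (Metric.closedBall x₀ r))
    (hφ : AnalyticOnNhd ℂ φ (Metric.closedBall x₀ r))
    (hφ0 : ∀ z ∈ Metric.closedBall (x₀ : ℂ) r, ‖φ z‖ ≤ A₁ * Φ)
    (hf1 : ∀ z ∈ Metric.closedBall (x₀ : ℂ) r, ‖deriv f z‖ ≤ A₂ * (F / r))
    (hfreal : (f x₀).im = 0) (hk : deriv f x₀ = -k)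
    (hq : deriv (deriv f) x₀ = q) (hqF : F ≤ A₃ * (r ^ 2 * q))
    (hβ : beta A₂ A₃ α < 1) (hα1 : α * √2 ≤ 3 / 5) (hα6 : π ^ 3 * α ^ 6 ≤ 48 * A₃ ^ 3)
    {h : ℂ → ℂ} (hh : h = fun z => φ z * Complex.exp (2 * π * Complex.I * (f z + k * z))) :
    ‖(1 + Complex.I) * r * (∫ s in (0 : ℝ)..α, (h (x₀ + r * ((1 + Complex.I) * s))
        + h (x₀ + r * (-((1 + Complex.I) * s))))) - mainTerm k x₀ φ f‖
      ≤ A₁ * (A₃ ^ 4 * B3 A₂ A₃ α + √A₃ * B4 A₂ A₃ α) * Φ * r * F ^ (-(3 / 2) : ℝ) := by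
  have hD : 0 < 1 - α * √2 := by linarith
  have hα1' : α * √2 < 1 := by linarith
  have hβ0 : 0 ≤ beta A₂ A₃ α := by rw [beta]; positivity
  set Q := r ^ 2 * q with hQdef
  have hQ : 0 < Q := pos_of_mul_pos_right (hF.trans_le hqF) hA₃.le
  have hq0 : 0 < q := pos_of_mul_pos_right hQ (by positivity)
  set K := A₁ * Φ with hKdef
  have hK : 0 < K := by positivity
  have hnz : ∀ s : ℝ, 0 ≤ s → ‖(1 + Complex.I) * s‖ = √2 * s := fun s hs => by
    rw [norm_mul, Complex.norm_real, Real.norm_eq_abs, abs_of_nonneg hs]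
    congr 1
    rw [Complex.norm_eq_sqrt_sq_add_sq]; norm_num
  have hsqz : ∀ s : ℝ, ((1 + Complex.I) * s) ^ 2 = 2 * Complex.I * s ^ 2 := fun s => by
    linear_combination (s : ℂ) ^ 2 * Complex.I_sq
  have hmem : ∀ z : ℂ, ‖z‖ ≤ 1 → (x₀ : ℂ) + r * z ∈ Metric.closedBall (x₀ : ℂ) r := fun z hz => by
    rw [Metric.mem_closedBall, dist_self_add_left, norm_mul, Complex.norm_real, Real.norm_eq_abs,
      abs_of_pos hr]
    nlinarith
  set g₀ : ℂ := f x₀ + k * x₀ with hg₀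
  set θ : ℂ → ℂ := fun z => f (x₀ + r * z) - (f x₀ + deriv f x₀ * (r * z) + q * r ^ 2 / 2 * z ^ 2)
    with hθ
  set e₀ := Complex.exp (2 * π * Complex.I * g₀) with he₀
  have he₀n : ‖e₀‖ = 1 := by
    have : g₀ = (((f x₀).re + k * x₀ : ℝ) : ℂ) := by
      apply Complex.ext <;> simp [hg₀, hfreal]
    rw [he₀, this, show 2 * π * Complex.I * ((((f x₀).re + k * x₀ : ℝ)) : ℂ)
      = ((2 * π * ((f x₀).re + k * x₀) : ℝ) : ℂ) * Complex.I by push_cast; ring,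
      Complex.norm_exp_ofReal_mul_I]
  set H : ℝ → ℂ := fun s => (φ (x₀ + r * ((1 + Complex.I) * s))
      * Complex.exp (2 * π * Complex.I * θ ((1 + Complex.I) * s))
      + φ (x₀ + r * (-((1 + Complex.I) * s)))
      * Complex.exp (2 * π * Complex.I * θ (-((1 + Complex.I) * s))))
      * (Real.exp (-(2 * π * Q) * s ^ 2) : ℝ) with hH
  -- At the saddle the linear terms of the phase cancel, and z² = 2is² turns the quadratic one into
  -- the real exponent -2πQs².
  have hfac : ∀ (s : ℝ) (z : ℂ), z ^ 2 = 2 * Complex.I * s ^ 2 →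
      h (x₀ + r * z) = e₀ * (φ (x₀ + r * z) * Complex.exp (2 * π * Complex.I * θ z)
        * (Real.exp (-(2 * π * Q) * s ^ 2) : ℝ)) := fun s z hz => by
    have : 2 * π * Complex.I * (f (x₀ + r * z) + k * (x₀ + r * z))
        = 2 * π * Complex.I * g₀ + (2 * π * Complex.I * θ z
          + ((-(2 * π * Q) * s ^ 2 : ℝ) : ℂ)) := by
      simp only [hθ, hg₀, hk, hz, hQdef]
      push_cast
      linear_combination (2 * π * q * r ^ 2 * (s : ℂ) ^ 2) * Complex.I_sq
    rw [hh]
    simp only []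
    rw [this, Complex.exp_add, Complex.exp_add, Complex.ofReal_exp]
    ring
  have hHh : ∀ s : ℝ, h (x₀ + r * ((1 + Complex.I) * s)) + h (x₀ + r * (-((1 + Complex.I) * s)))
      = e₀ * H s := fun s => by
    rw [hfac s _ (hsqz s), hfac s _ (by rw [neg_sq, hsqz s])]
    simp only [hH]
    ring
  have hzb : ∀ s ∈ Icc 0 α, ‖(1 + Complex.I) * s‖ ≤ α * √2 := fun s hs => by
    rw [hnz s hs.1, mul_comm]
    gcongr
    exact hs.2
  have hHc : ContinuousOn H (Icc 0 α) := by
    have hl : ∀ σ : ℂ, ‖σ‖ = 1 → ∀ g : ℂ → ℂ, AnalyticOnNhd ℂ g (Metric.closedBall x₀ r) →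
        ContinuousOn (fun s : ℝ => g (x₀ + r * (σ * ((1 + Complex.I) * s)))) (Icc 0 α) :=
      fun σ hσ g hg => hg.continuousOn.comp (f := fun s : ℝ => (x₀ : ℂ) + r * (σ *
        ((1 + Complex.I) * s))) (by fun_prop) fun s hs => hmem _ (by
          rw [norm_mul, hσ, one_mul]; exact (hzb s hs).trans hα1'.le)
    have h1 := hl 1 (by simp) f hf
    have h2 := hl 1 (by simp) φ hφ
    have h3 := hl (-1) (by simp) f hf
    have h4 := hl (-1) (by simp) φ hφ
    simp only [one_mul, neg_one_mul] at h1 h2 h3 h4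
    simp only [hH, hθ]
    refine ContinuousOn.mul (ContinuousOn.add (h2.mul ?_) (h4.mul ?_)) (by fun_prop)
    · exact Complex.continuous_exp.comp_continuousOn
        (continuousOn_const.mul (h1.sub (by fun_prop)))
    · exact Complex.continuous_exp.comp_continuousOn
        (continuousOn_const.mul (h3.sub (by fun_prop)))
  obtain ⟨η, hη, hηα, hFη, hT⟩ :=
    gaussian_tails_le hA₃ hF hα hqF (sub_pos.2 hβ) (by linarith) hα6
  have hb : 0 < 2 * π * Q := by positivity
  have hω2 : 0 ≤ omega2 A₂ α := by rw [omega2_eq hα1']; positivity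
  have hω3 : 0 ≤ omega3 A₂ α := by rw [omega3]; positivity
  have hnear : ∀ s ∈ Icc 0 η, ‖H s - 2 * φ x₀ * Real.exp (-(2 * π * Q) * s ^ 2)‖
      ≤ 2 * K * ((2 * (1 + α ^ 3 * omega3 A₂ α) / (1 - α * √2) * s ^ 2
        + F * (2 * π * A₂ / (1 - α * √2) + omega3 A₂ α * √2) * s ^ 4
        + omega2 A₂ α * F ^ 2 * s ^ 6) * Real.exp (-(2 * π * Q) * s ^ 2)) := fun s hs => by
    have hsα : s ≤ α := hs.2.trans hηα
    have hs0 := hs.1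
    have hsI : s ∈ Icc 0 α := ⟨hs0, hsα⟩
    set z : ℂ := (1 + Complex.I) * s with hz
    have hzn : ‖z‖ = √2 * s := hnz s hs.1
    have hs2 : √2 ^ 2 = 2 := Real.sq_sqrt (by norm_num)
    have hφT : ∀ v : ℂ, ‖v‖ = √2 * s → ‖φ (x₀ + r * v) - (φ x₀ + (deriv φ x₀ * r) * v)‖
        ≤ K * (2 * s ^ 2 / (1 - α * √2)) := fun v hv => by
      have hv1 : ‖v‖ ≤ α * √2 := by rw [hv, ← hzn]; exact hzb s hsI
      have := norm_sub_taylor_le hr hφ (m := 2)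
        (fun n _ => norm_iteratedDeriv_mul_pow_le hr hφ hφ0 n) (hv1.trans_lt hα1')
      simp only [Finset.sum_range_succ, Finset.sum_range_zero, iteratedDeriv_succ',
        iteratedDeriv_zero, Nat.factorial] at this
      norm_num at this
      refine this.trans ?_
      have e : ‖v‖ ^ 2 = 2 * s ^ 2 := by rw [hv, mul_pow, hs2]
      rw [mul_div_assoc, e]
      gcongr
    have hfT : ∀ v : ℂ, ‖v‖ = √2 * s →
        ‖θ v - (iteratedDeriv 2 (deriv f) x₀ * r ^ 3 / 6) * v ^ 3‖
        ≤ A₂ * F * s ^ 4 / (1 - α * √2) := fun v hv => by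
      have hv1 : ‖v‖ ≤ α * √2 := by rw [hv, ← hzn]; exact hzb s hsI
      have := norm_sub_taylor_le_of_norm_deriv_le hr hf hf1 (m := 4) (by norm_num)
        (hv1.trans_lt hα1')
      have e4 : ‖v‖ ^ 4 = 4 * s ^ 4 := by
        rw [hv, mul_pow, show √2 ^ 4 = (√2 ^ 2) ^ 2 by ring, hs2]; norm_num
      calc _ = ‖f (x₀ + r * v) - ∑ n ∈ Finset.range 4,
            iteratedDeriv n f x₀ * r ^ n / n.factorial * v ^ n‖ := by
            congr 1
            simp only [Finset.sum_range_succ, Finset.sum_range_zero, iteratedDeriv_succ',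
              iteratedDeriv_zero, Nat.factorial, hθ, hq]
            push_cast
            ring
        _ ≤ _ := this
        _ = A₂ * F * s ^ 4 / (1 - ‖v‖) := by rw [e4]; push_cast; field_simp
        _ ≤ _ := by gcongr
    have hp₁ : ‖deriv φ x₀ * r‖ ≤ K := by
      have := norm_iteratedDeriv_mul_pow_le hr hφ hφ0 1
      rw [norm_mul, Complex.norm_real, Real.norm_eq_abs, abs_of_pos hr]
      simpa using this
    have hc : ‖iteratedDeriv 2 (deriv f) x₀ * r ^ 3 / 6‖ ≤ A₂ * F / 3 := by
      have := norm_iteratedDeriv_mul_pow_le hr hf.deriv hf1 2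
      rw [norm_div, norm_mul, norm_pow, Complex.norm_real, Real.norm_eq_abs, abs_of_pos hr,
        Complex.norm_ofNat, div_le_iff₀ (by norm_num)]
      calc _ = ‖iteratedDeriv 2 (deriv f) x₀‖ * r ^ 2 * r := by ring
        _ ≤ ((Nat.factorial 2 : ℕ) * (A₂ * (F / r))) * r := by gcongr
        _ = _ := by norm_num [Nat.factorial]; field_simp; norm_num
    have key := norm_symmetrized_sub_le (z := z) hA₂ hF hK.le hα hα1 hs0 hsα
      ((by gcongr; exact hs.2 : F * s ^ 3 ≤ F * η ^ 3).trans hFη) hzn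
      (hφ0 x₀ (Metric.mem_closedBall_self hr.le)) hp₁ hc (hφT z hzn)
      (hφT (-z) (by rw [norm_neg, hzn])) (hfT z hzn) (hfT (-z) (by rw [norm_neg, hzn]))
      (add_sub_cancel _ _).symm (add_sub_cancel _ _).symm
    rw [add_sub_cancel, add_sub_cancel] at key
    have hE : (0 : ℝ) ≤ Real.exp (-(2 * π * Q) * s ^ 2) := (Real.exp_pos _).le
    calc _ = ‖(φ (x₀ + r * z) * Complex.exp (2 * π * Complex.I * θ z)
          + φ (x₀ + r * (-z)) * Complex.exp (2 * π * Complex.I * θ (-z)) - 2 * φ x₀)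
          * (Real.exp (-(2 * π * Q) * s ^ 2) : ℝ)‖ := by
          congr 1; simp only [hH]; ring
      _ ≤ _ := by
          rw [norm_mul, Complex.norm_real, Real.norm_eq_abs, abs_of_nonneg hE]
          exact (mul_le_mul_of_nonneg_right key hE).trans_eq (by ring)
  -- No cancellation is needed here: the phase remainder costs e^{2πβQs²}, leaving the rate 1-β.
  have hfar : ∀ s ∈ Icc η α, ‖H s‖
      ≤ 2 * K * Real.exp (-(2 * π * (1 - beta A₂ A₃ α) * Q) * s ^ 2) := fun s hs => by
    have hs0 : 0 ≤ s := hη.le.trans hs.1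
    have hsI : s ∈ Icc 0 α := ⟨hs0, hs.2⟩
    have one : ∀ v : ℂ, ‖v‖ = √2 * s →
        ‖φ (x₀ + r * v) * Complex.exp (2 * π * Complex.I * θ v)‖
          ≤ K * Real.exp (2 * π * (beta A₂ A₃ α * Q * s ^ 2)) := fun v hv => by
      have hv1 : ‖v‖ ≤ 1 := by
        rw [hv, ← hnz s hs0]; exact (hzb s hsI).trans hα1'.le
      have hb' := norm_phase_sub_quadratic_le hr hF hA₂ hA₃ hα hα1' hf hf1 hq hqF hs.2 hv
      rw [norm_mul]
      refine mul_le_mul (hφ0 _ (hmem v hv1)) ((Complex.norm_exp_le_exp_norm _).trans ?_)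
        (norm_nonneg _) hK.le
      rw [Real.exp_le_exp, norm_mul, norm_mul, norm_mul, Complex.norm_I, Complex.norm_real,
        Complex.norm_ofNat, Real.norm_eq_abs, abs_of_pos Real.pi_pos, mul_one]
      gcongr
    have hE : (0 : ℝ) ≤ Real.exp (-(2 * π * Q) * s ^ 2) := (Real.exp_pos _).le
    simp only [hH]
    rw [norm_mul, Complex.norm_real, Real.norm_eq_abs, abs_of_nonneg hE]
    calc _ ≤ (K * Real.exp (2 * π * (beta A₂ A₃ α * Q * s ^ 2))
          + K * Real.exp (2 * π * (beta A₂ A₃ α * Q * s ^ 2)))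
          * Real.exp (-(2 * π * Q) * s ^ 2) := by
          gcongr
          exact (norm_add_le _ _).trans (add_le_add (one _ (hnz s hs0))
            (one _ (by rw [norm_neg, hnz s hs0])))
      _ = 2 * K * (Real.exp (2 * π * (beta A₂ A₃ α * Q * s ^ 2))
          * Real.exp (-(2 * π * Q) * s ^ 2)) := by ring
      _ = _ := by rw [← Real.exp_add]; congr 2; ring
  have hest := norm_integral_sub_gaussian_le hK.le hη hηα hb
    (c₂ := 2 * (1 + α ^ 3 * omega3 A₂ α) / (1 - α * √2))
    (c₄ := F * (2 * π * A₂ / (1 - α * √2) + omega3 A₂ α * √2))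
    (c₆ := omega2 A₂ α * F ^ 2) (by positivity) (by positivity) (by positivity) hHc
    (hφ0 x₀ (Metric.mem_closedBall_self hr.le)) hnear hfar le_rfl
  have hmom := gaussian_moments_le hA₂ hA₃ hF hα hα1' hqF
  have hint : ∫ s in (0 : ℝ)..α, (h (x₀ + r * ((1 + Complex.I) * s))
        + h (x₀ + r * (-((1 + Complex.I) * s)))) = e₀ * ∫ s in (0 : ℝ)..α, H s := by
    rw [← intervalIntegral.integral_const_mul]
    exact intervalIntegral.integral_congr fun s _ => hHh s
  rw [hint, mainTerm_eq hr hq0 hq, ← mul_sub, ← mul_sub, norm_mul, norm_mul, norm_mul, he₀n,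
    one_mul, Complex.norm_real, Real.norm_eq_abs, abs_of_pos hr]
  have h1I : ‖1 + Complex.I‖ = √2 := by simpa using hnz 1 zero_le_one
  rw [h1I]
  calc _ ≤ _ := mul_le_mul_of_nonneg_left hest (by positivity)
    _ = K * r * (2 * √2 * (√(π / (2 * π * Q)) / 2
      * (2 * (1 + α ^ 3 * omega3 A₂ α) / (1 - α * √2) * (1 / (2 * (2 * π * Q)))
        + F * (2 * π * A₂ / (1 - α * √2) + omega3 A₂ α * √2) * (3 / (2 * (2 * π * Q)) ^ 2)
        + omega2 A₂ α * F ^ 2 * (15 / (2 * (2 * π * Q)) ^ 3)))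
      + 2 * √2 * ((∫ t in Ioi η, Real.exp (-(2 * π * Q) * t ^ 2))
        + ∫ t in Ioc η α, Real.exp (-(2 * π * (1 - beta A₂ A₃ α) * Q) * t ^ 2))) := by ring
    _ ≤ K * r * (√A₃ * B4 A₂ A₃ α * F ^ (-(3 / 2) : ℝ)
        + A₃ ^ 4 * B3 A₂ A₃ α * F ^ (-(3 / 2) : ℝ)) := by gcongr
    _ = _ := by rw [hKdef]; ring

/-! ### Decay on the shifted contour -/

/-- The complex derivative can be computed along the real axis; uniqueness of derivatives within
[a,b] covers the endpoints. -/
theorem im_deriv_eq_zero_of_real {g : ℂ → ℂ} {a b : ℝ} (hab : a < b)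
    (hg : ∀ x ∈ Icc a b, AnalyticAt ℂ g (x : ℂ)) (hreal : ∀ x ∈ Icc a b, (g (x : ℂ)).im = 0)
    {x : ℝ} (hx : x ∈ Icc a b) : (deriv g (x : ℂ)).im = 0 := by
  have h1 : HasDerivAt (fun y : ℝ => (g y).im) (deriv g x).im x :=
    Complex.imCLM.hasFDerivAt.comp_hasDerivAt x
      (hg x hx).differentiableAt.hasDerivAt.comp_ofReal
  have h2 : HasDerivWithinAt (fun y : ℝ => (g y).im) 0 (Icc a b) x :=
    (hasDerivWithinAt_const x _ (0 : ℝ)).congr hreal (hreal x hx)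
  exact (uniqueDiffOn_Icc hab x hx).eq_deriv _ h1.hasDerivWithinAt h2

theorem add_mul_mem_closedBall {x : ℂ} {r : ℝ} (hr : 0 ≤ r) {z : ℂ} (hz : ‖z‖ ≤ 1) :
    x + r * z ∈ Metric.closedBall x r := by
  rw [Metric.mem_closedBall, dist_self_add_left, norm_mul, Complex.norm_real, Real.norm_eq_abs,
    abs_of_nonneg hr]
  exact mul_le_of_le_one_right hr hz

theorem norm_direction {ε α t : ℝ} (hε : |ε| = 1) (hα : 0 ≤ α) (ht : 0 ≤ t) :
    ‖(ε * (1 + Complex.I) * α * t : ℂ)‖ = √2 * (α * t) := by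
  have h1 : ‖1 + Complex.I‖ = √2 := by
    rw [Complex.norm_eq_sqrt_sq_add_sq]; norm_num
  rw [norm_mul, norm_mul, norm_mul, h1, Complex.norm_real, Complex.norm_real, Complex.norm_real,
    Real.norm_eq_abs, Real.norm_eq_abs, Real.norm_eq_abs, hε, abs_of_nonneg hα, abs_of_nonneg ht]
  ring

/-- With ε the sign of d+k, the imaginary part of the linear phase term is |d+k|αrt ≥ 0. The
quadratic term gives q(αrt)² for either ε, since ε² = 1, and the remainder removes at most its share
β. -/
theorem norm_integrand_le {f φ : ℂ → ℂ} {x k r d q A₁ A₂ A₃ F Φ α ε t : ℝ} (hr : 0 < r)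
    (hF : 0 < F) (hA₁ : 0 < A₁) (hΦ : 0 < Φ) (hA₂ : 0 < A₂) (hA₃ : 0 < A₃) (hα : 0 < α)
    (hα1 : α * √2 < 1)
    (hf : AnalyticOnNhd ℂ f (Metric.closedBall x r))
    (hφ0 : ∀ z ∈ Metric.closedBall (x : ℂ) r, ‖φ z‖ ≤ A₁ * Φ)
    (hf1 : ∀ z ∈ Metric.closedBall (x : ℂ) r, ‖deriv f z‖ ≤ A₂ * (F / r))
    (hfreal : (f x).im = 0) (hd : deriv f x = d) (hq : deriv (deriv f) x = q)
    (hqF : F ≤ A₃ * (r ^ 2 * q)) (hε : |ε| = 1) (hεd : ε * (d + k) = |d + k|)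
    (ht : t ∈ Icc (0 : ℝ) 1) {h : ℂ → ℂ}
    (hh : h = fun z => φ z * Complex.exp (2 * π * Complex.I * (f z + k * z))) :
    ‖h (x + (ε * (1 + Complex.I) * α) * t * r)‖
      ≤ A₁ * Φ * Real.exp (-(2 * π * (|d + k| * (α * r) * t
        + (1 - beta A₂ A₃ α) * (q * (α * r) ^ 2) * t ^ 2))) := by
  set z : ℂ := ε * (1 + Complex.I) * α * t with hz
  have hzn : ‖z‖ = √2 * (α * t) := norm_direction hε hα.le ht.1
  have hαt : α * t ≤ α := mul_le_of_le_one_right hα.le ht.2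
  have hz1 : ‖z‖ ≤ 1 := by
    rw [hzn]
    calc _ ≤ √2 * α := by gcongr
      _ ≤ 1 := by rw [mul_comm]; exact hα1.le
  rw [show (x : ℂ) + (ε * (1 + Complex.I) * α) * t * r = x + r * z by rw [hz]; ring]
  have hθ := norm_phase_sub_quadratic_le hr hF hA₂ hA₃ hα hα1 hf hf1 hq hqF hαt hzn
  set θ := f (x + r * z) - (f x + deriv f x * (r * z) + q * r ^ 2 / 2 * z ^ 2) with hθdef
  have hε2 : (ε : ℂ) ^ 2 = 1 := by
    rw [← Complex.ofReal_pow, ← sq_abs, hε]; norm_num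
  have hz2 : z ^ 2 = 2 * Complex.I * (α * t) ^ 2 := by
    rw [hz]
    linear_combination ((ε : ℂ) ^ 2 * (α * t) ^ 2) * Complex.I_sq
      + (2 * Complex.I * (α * t) ^ 2) * hε2
  have hdecomp : f (x + r * z) + k * (x + r * z)
      = (((f x).re + k * x + ε * (d + k) * r * (α * t) : ℝ) : ℂ)
        + ((ε * (d + k) * r * (α * t) + q * r ^ 2 * (α * t) ^ 2 : ℝ) : ℂ) * Complex.I + θ := by
    have e : f x = ((f x).re : ℂ) := Complex.ext (by simp) (by simpa using hfreal)
    rw [hθdef, hd, hz2]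
    push_cast
    rw [← e]
    rw [hz]
    ring
  have him : |θ.im| ≤ beta A₂ A₃ α * (r ^ 2 * q) * (α * t) ^ 2 :=
    (Complex.abs_im_le_norm θ).trans hθ
  have hnexp : ‖Complex.exp (2 * π * Complex.I * (f (x + r * z) + k * (x + r * z)))‖
      = Real.exp (-(2 * π * (|d + k| * r * (α * t) + q * r ^ 2 * (α * t) ^ 2 + θ.im))) := by
    have hre : ∀ w : ℂ, (2 * π * Complex.I * w).re = -(2 * π * w.im) := fun w => by
      rw [show 2 * π * Complex.I * w = ((2 * π : ℝ) : ℂ) * (Complex.I * w) by push_cast; ring,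
        Complex.re_ofReal_mul, Complex.I_mul_re]
      ring
    rw [Complex.norm_exp, hdecomp, hεd, hre, Complex.add_im, Complex.add_im, Complex.ofReal_im,
      Complex.im_ofReal_mul, Complex.I_im]
    congr 1
    ring
  rw [hh]
  simp only []
  rw [norm_mul, hnexp]
  refine mul_le_mul (hφ0 _ (add_mul_mem_closedBall hr.le hz1)) ?_ (by positivity) (by positivity)
  rw [Real.exp_le_exp, neg_le_neg_iff]
  refine mul_le_mul_of_nonneg_left ?_ (by positivity)
  have := (abs_le.1 him).1
  linarith

/-- The length factor √2αr of the segment matches `endpoint_integral_le` with P = |D|αr and √Q =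
√q·αr, so α and r drop out of the bound. -/
theorem norm_endpoint_integral_le {h : ℂ → ℂ} {x r D q A₁ A₂ A₃ Φ α ε : ℝ} (hr : 0 < r)
    (hA₁ : 0 < A₁) (hΦ : 0 < Φ) (hα : 0 < α) (hq : 0 < q)
    (hβ : beta A₂ A₃ α < 1) (hβ0 : 0 ≤ beta A₂ A₃ α) (hε : |ε| = 1)
    (hh : ∀ t ∈ Icc (0 : ℝ) 1, ‖h (x + (ε * (1 + Complex.I) * α) * t * r)‖
      ≤ A₁ * Φ * Real.exp (-(2 * π * (|D| * (α * r) * t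
        + (1 - beta A₂ A₃ α) * (q * (α * r) ^ 2) * t ^ 2)))) :
    ‖∫ t in (0 : ℝ)..1, h (x + (ε * (1 + Complex.I) * α) * t * r)
        * ((ε * (1 + Complex.I) * α) * r)‖
      ≤ A₁ * B1 A₂ A₃ α * (Φ / (|D| + √q)) := by
  have hγ : 0 < 1 - beta A₂ A₃ α := by linarith
  have hc : ‖(ε * (1 + Complex.I) * α * r : ℂ)‖ = √2 * (α * r) := norm_direction hε hα.le hr.le
  set J := ∫ t in (0 : ℝ)..1, Real.exp (-(2 * π * (|D| * (α * r) * t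
        + (1 - beta A₂ A₃ α) * (q * (α * r) ^ 2) * t ^ 2))) with hJ
  have hend := endpoint_integral_le (P := |D| * (α * r)) (Q := q * (α * r) ^ 2) (by positivity)
    (by positivity) hγ (by linarith)
  -- The first summand of B₁ suffices; the exponential summand is slack.
  have hB1 : 1 / (1 - beta A₂ A₃ α) ≤ B1 A₂ A₃ α := by
    rw [B1, le_add_iff_nonneg_right]; positivity
  rw [Real.sqrt_mul hq.le, Real.sqrt_sq (by positivity), ← hJ] at hend
  have hsum : 0 < |D| + √q := by positivity
  calc _ ≤ ∫ t in (0 : ℝ)..1, A₁ * Φ * (√2 * (α * r)) * Real.exp (-(2 * π * (|D| * (α * r) * t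
        + (1 - beta A₂ A₃ α) * (q * (α * r) ^ 2) * t ^ 2))) := by
        refine intervalIntegral.norm_integral_le_of_norm_le zero_le_one
          (.of_forall fun t ht => ?_) (Continuous.intervalIntegrable (by fun_prop) _ _)
        rw [norm_mul, hc]
        exact (mul_le_mul_of_nonneg_right (hh t (Ioc_subset_Icc_self ht))
          (by positivity)).trans_eq (by ring)
    _ = A₁ * Φ * (√2 * (α * r) * J) := by
        rw [intervalIntegral.integral_const_mul, ← hJ]; ring
    _ ≤ A₁ * Φ * (B1 A₂ A₃ α / (|D| + √q)) := by
        gcongr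
        rw [le_div_iff₀ hsum]
        calc _ = √2 * (|D| * (α * r) + √q * (α * r)) * J := by ring
          _ ≤ _ := hend.trans hB1
    _ = _ := by ring

/-- Either |d+k| is comparable to |k|, or |k| is paid for by |d| ≤ A₂F/r and so by the quadratic
decay. The inequality |k| ≤ |d+k| + |d| treats both at once. -/
theorem curve_exponent_le {k r d q A₂ A₃ F α : ℝ} (hr : 0 < r)
    (hF : 0 < F) (hA₂ : 0 < A₂) (hA₃ : 0 < A₃) (hα : 0 < α)
    (hα2 : α ≤ A₃ * (1 + 2 * A₂) / 2) (hβ : beta A₂ A₃ α < 1) (hβ0 : 0 ≤ beta A₂ A₃ α)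
    (hd : |d| ≤ A₂ * (F / r)) (hqF : F ≤ A₃ * (r ^ 2 * q)) :
    -(2 * π * (|d + k| * (α * r) + (1 - beta A₂ A₃ α) * (q * (α * r) ^ 2)))
      ≤ B2 A₂ A₃ α * (-|k| * r - F) := by
  have hγ : 0 < 1 - beta A₂ A₃ α := by linarith
  rw [B2]
  set γ := 1 - beta A₂ A₃ α
  have hγ1 : γ ≤ 1 := by simp only [γ]; linarith
  have hA : 0 < A₃ * (1 + 2 * A₂) := by positivity
  -- κ = B₂/(2π), chosen so that κ ≤ α and κ(1+2A₂)F is at most the quadratic decay.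
  set κ := α ^ 2 * γ / (A₃ * (1 + 2 * A₂)) with hκ
  have hκ0 : 0 < κ := by positivity
  have hκα : κ ≤ α := by
    rw [hκ, div_le_iff₀ hA]
    have : α * γ ≤ A₃ * (1 + 2 * A₂) := by nlinarith
    nlinarith
  have hk : |k| * r ≤ |d + k| * r + A₂ * F := by
    have h1 : |k| ≤ |d + k| + |d| := by
      calc |k| = |(d + k) - d| := by congr 1; ring
        _ ≤ _ := abs_sub _ _
    calc |k| * r ≤ (|d + k| + A₂ * (F / r)) * r := by gcongr; linarith
      _ = _ := by field_simp
  have hκF : κ * (1 + 2 * A₂) * F ≤ γ * (q * (α * r) ^ 2) := by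
    have e : κ * (1 + 2 * A₂) = α ^ 2 * γ / A₃ := by rw [hκ]; field_simp
    rw [e, div_mul_eq_mul_div, div_le_iff₀ hA₃]
    calc _ ≤ α ^ 2 * γ * (A₃ * (r ^ 2 * q)) := by gcongr
      _ = _ := by ring
  have e2 : 2 * π * α ^ 2 * γ / (A₃ * (1 + 2 * A₂)) = 2 * π * κ := by rw [hκ]; ring
  rw [e2]
  have key : κ * (|k| * r + F) ≤ |d + k| * (α * r) + γ * (q * (α * r) ^ 2) := by
    calc _ ≤ κ * (|d + k| * r + A₂ * F + F) := by gcongr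
      _ ≤ κ * (|d + k| * r) + κ * (1 + 2 * A₂) * F := by
          have : 0 ≤ κ * (A₂ * F) := by positivity
          nlinarith
      _ ≤ α * (|d + k| * r) + γ * (q * (α * r) ^ 2) := by gcongr
      _ = _ := by ring
  have := mul_le_mul_of_nonneg_left key (by positivity : 0 ≤ 2 * π)
  linarith

/-- The majorant may be non-measurable or have infinite integral, so the estimate is made in
`ENNReal`, with steps that need neither measurability nor integrability of it. -/
theorem norm_curve_integral_le {h : ℂ → ℂ} {u v k A₁ A₂ A₃ α ε : ℝ} {μ ν F Φ : ℝ → ℝ}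
    (huv : u ≤ v) (hA₁ : 0 < A₁) (hΦ : ∀ x ∈ Icc u v, 0 < Φ x) (hα : 0 < α) (hε : |ε| = 1)
    (hh : ∀ x ∈ Icc u v, ‖h (x + (ε * (1 + Complex.I) * α) * μ x)‖
      ≤ A₁ * Φ x * Real.exp (B2 A₂ A₃ α * (-|k| * μ x - F x))) :
    ENNReal.ofReal ‖∫ x in u..v, h (x + (ε * (1 + Complex.I) * α) * μ x)
        * (1 + (ε * (1 + Complex.I) * α) * ν x)‖
      ≤ ENNReal.ofReal A₁ * ∫⁻ x in Ioc u v, ENNReal.ofReal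
        (Φ x * Real.exp (B2 A₂ A₃ α * (-|k| * μ x - F x)) * (1 + α * √2 * |ν x|)) := by
  rw [intervalIntegral.integral_of_le huv, ofReal_norm,
    ← lintegral_const_mul' _ _ ENNReal.ofReal_ne_top]
  refine (enorm_integral_le_lintegral_enorm _).trans ?_
  refine setLIntegral_mono' measurableSet_Ioc fun x hx => ?_
  have hx' := Ioc_subset_Icc_self hx
  rw [← ENNReal.ofReal_mul hA₁.le, ← ofReal_norm]
  refine ENNReal.ofReal_le_ofReal ?_
  have hc : ‖(ε * (1 + Complex.I) * α * ν x : ℂ)‖ = α * √2 * |ν x| := by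
    have := norm_direction (t := 1) hε hα.le zero_le_one
    rw [Complex.ofReal_one, mul_one, mul_one] at this
    rw [norm_mul, this, Complex.norm_real, Real.norm_eq_abs]
    ring
  have hΦx := hΦ x hx'
  rw [norm_mul]
  calc _ ≤ A₁ * Φ x * Real.exp (B2 A₂ A₃ α * (-|k| * μ x - F x)) * (1 + α * √2 * |ν x|) := by
        gcongr
        · exact hh x hx'
        · exact (norm_add_le _ _).trans (by rw [norm_one, hc])
    _ = _ := by ring

/-- The substitution s = αt puts the segments at x₀ for ε = 1 and ε = -1 in the form used by the
saddle estimate. -/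
theorem endpoint_integral_eq {h : ℂ → ℂ} {x r α : ℝ} (ε : ℂ) :
    ∫ t in (0 : ℝ)..1, h (x + (ε * (1 + Complex.I) * α) * t * r) * ((ε * (1 + Complex.I) * α) * r)
      = ε * ((1 + Complex.I) * r * ∫ s in (0 : ℝ)..α, h (x + r * (ε * ((1 + Complex.I) * s)))) := by
  have := intervalIntegral.smul_integral_comp_mul_left (a := 0) (b := 1)
    (fun s : ℝ => h (x + r * (ε * ((1 + Complex.I) * s)))) α
  rw [mul_zero, mul_one] at this
  rw [← this, intervalIntegral.integral_mul_const, Complex.real_smul]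
  have e : ∀ t : ℝ, h (x + (ε * (1 + Complex.I) * α) * t * r)
      = h (x + r * (ε * ((1 + Complex.I) * (α * t : ℝ)))) := fun t => by
    congr 1; push_cast; ring
  simp only [e]
  ring

/-! ### Parameter constraints and assembly -/

theorem parameter_consequences {A₂ A₃ α : ℝ} (hA₂ : 0 < A₂) (hA₃ : 0 < A₃) (hA : 1 ≤ A₂ * A₃)
    (hα : 0 < α) (hlt : α < min (1 / ((1 + 2 * A₂ * A₃ / 3) * √2))
      (min (A₃ * (1 + 2 * A₂) / 2) ((48 * A₃ ^ 3 / π ^ 3) ^ (1 / 6 : ℝ)))) :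
    α * √2 ≤ 3 / 5 ∧ 0 ≤ beta A₂ A₃ α ∧ beta A₂ A₃ α < 1 ∧ α ≤ A₃ * (1 + 2 * A₂) / 2 ∧
      π ^ 3 * α ^ 6 ≤ 48 * A₃ ^ 3 := by
  have hπ := Real.pi_pos
  obtain ⟨h1, h2, h3⟩ := by simpa only [lt_min_iff] using hlt
  have h2' : 0 < √2 := by positivity
  rw [lt_div_iff₀ (by positivity)] at h1
  -- From A₂A₃ ≥ 1 one has 1 + 2A₂A₃/3 ≥ 5/3.
  have hb : α * √2 ≤ 3 / 5 := by nlinarith [mul_pos hα h2']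
  have hD : 0 < 1 - α * √2 := by linarith
  refine ⟨hb, ?_, ?_, h2.le, ?_⟩
  · rw [beta]; positivity
  -- β < 1 is the first constraint on α₀, cleared of denominators.
  · rw [beta, div_lt_one (by positivity)]
    nlinarith
  · have : α ^ 6 ≤ 48 * A₃ ^ 3 / π ^ 3 := by
      calc α ^ 6 ≤ ((48 * A₃ ^ 3 / π ^ 3) ^ (1 / 6 : ℝ)) ^ 6 := by gcongr
        _ = _ := by
          rw [← Real.rpow_natCast, ← Real.rpow_mul (by positivity)]
          norm_num
    rwa [le_div_iff₀ (by positivity), mul_comm] at this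

/-- One shift on a piece where ε(f'+k) = |f'+k|. The derivative of μ is taken within [a,b] rather
than [u,v], so that different pieces have the integrand of `bound2` in common. -/
theorem exists_shifted_decomposition {a b u v k : ℝ} {f φ : ℂ → ℂ} {μ F Φ d q : ℝ → ℝ}
    {A₁ A₂ A₃ α ε : ℝ} (hab : a < b) (huv : u ≤ v) (hsub : Icc u v ⊆ Icc a b)
    (hμ : ContDiffOn ℝ 1 μ (Icc a b)) (hμpos : ∀ x ∈ Icc a b, 0 < μ x)
    (hf : ∀ x ∈ Icc a b, AnalyticOnNhd ℂ f (Metric.closedBall (x : ℂ) (μ x)))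
    (hφ : ∀ x ∈ Icc a b, AnalyticOnNhd ℂ φ (Metric.closedBall (x : ℂ) (μ x)))
    (hF : ∀ x ∈ Icc a b, 0 < F x) (hΦ : ∀ x ∈ Icc a b, 0 < Φ x)
    (hA₁ : 0 < A₁) (hA₂ : 0 < A₂) (hA₃ : 0 < A₃) (hα : 0 < α) (hα1 : α * √2 < 1)
    (hα2 : α ≤ A₃ * (1 + 2 * A₂) / 2) (hβ : beta A₂ A₃ α < 1) (hβ0 : 0 ≤ beta A₂ A₃ α)
    (hφ0 : ∀ x ∈ Icc a b, ∀ z ∈ Metric.closedBall (x : ℂ) (μ x), ‖φ z‖ ≤ A₁ * Φ x)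
    (hf1 : ∀ x ∈ Icc a b, ∀ z ∈ Metric.closedBall (x : ℂ) (μ x), ‖deriv f z‖ ≤ A₂ * (F x / μ x))
    (hfreal : ∀ x ∈ Icc a b, (f (x : ℂ)).im = 0)
    (hd : ∀ x ∈ Icc a b, deriv f (x : ℂ) = d x)
    (hq : ∀ x ∈ Icc a b, deriv (deriv f) (x : ℂ) = q x)
    (hqF : ∀ x ∈ Icc a b, F x ≤ A₃ * (μ x ^ 2 * q x))
    (hε : |ε| = 1) (hεd : ∀ x ∈ Icc u v, ε * (d x + k) = |d x + k|) {h : ℂ → ℂ}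
    (hh : h = fun z => φ z * Complex.exp (2 * π * Complex.I * (f z + k * z)))
    {S : ℝ → ℂ} (hS : S = fun x => ∫ t in (0 : ℝ)..1,
      h (x + (ε * (1 + Complex.I) * α) * t * μ x) * ((ε * (1 + Complex.I) * α) * μ x)) :
    (∀ x ∈ Icc u v, ‖S x‖ ≤ A₁ * B1 A₂ A₃ α * (Φ x / (|d x + k| + √(q x)))) ∧
    ∃ C : ℂ, (∫ x in u..v, h (x : ℂ)) = S u + C - S v ∧
      ENNReal.ofReal ‖C‖ ≤ ENNReal.ofReal A₁ * ∫⁻ x in Ioc u v, ENNReal.ofReal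
        (Φ x * Real.exp (B2 A₂ A₃ α * (-|k| * μ x - F x))
          * (1 + α * √2 * |derivWithin μ (Icc a b) x|)) := by
  have hbound : ∀ x ∈ Icc u v, ∀ t ∈ Icc (0 : ℝ) 1,
      ‖h (x + (ε * (1 + Complex.I) * α) * t * μ x)‖
      ≤ A₁ * Φ x * Real.exp (-(2 * π * (|d x + k| * (α * μ x) * t
        + (1 - beta A₂ A₃ α) * (q x * (α * μ x) ^ 2) * t ^ 2))) := fun x hx t ht => by
    have hx' := hsub hx
    exact norm_integrand_le (hμpos x hx') (hF x hx') hA₁ (hΦ x hx') hA₂ hA₃ hα hα1 (hf x hx')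
      (hφ0 x hx') (hf1 x hx') (hfreal x hx') (hd x hx') (hq x hx') (hqF x hx') hε (hεd x hx) ht hh
  constructor
  · intro x hx
    have hx' := hsub hx
    have hq0 : 0 < q x := by
      have h1 := (hF x hx').trans_le (hqF x hx')
      exact pos_of_mul_pos_right (pos_of_mul_pos_right h1 hA₃.le) (by positivity)
    rw [hS]
    exact norm_endpoint_integral_le (hμpos x hx') hA₁ (hΦ x hx') hα hq0 hβ hβ0 hε (hbound x hx)
  · refine ⟨∫ x in u..v, h (x + (ε * (1 + Complex.I) * α) * μ x)
        * (1 + (ε * (1 + Complex.I) * α) * derivWithin μ (Icc a b) x), ?_, ?_⟩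
    · rw [hS]
      refine integral_contour_shift huv (fun x hx => ?_) ?_ fun x hx t ht => ?_
      · exact (hμ.differentiableOn one_ne_zero x (hsub hx)).hasDerivWithinAt.mono hsub
      · exact (hμ.continuousOn_derivWithin (uniqueDiffOn_Icc hab) le_rfl).mono hsub
      · have hx' := hsub hx
        have hz : ‖(ε * (1 + Complex.I) * α * t : ℂ)‖ ≤ 1 := by
          rw [norm_direction hε hα.le ht.1]
          have : α * t ≤ α := mul_le_of_le_one_right hα.le ht.2
          nlinarith [Real.sqrt_nonneg 2]
        have hm := add_mul_mem_closedBall (x := (x : ℂ)) (hμpos x hx').le hz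
        rw [show (x : ℂ) + μ x * (ε * (1 + Complex.I) * α * t)
          = x + (ε * (1 + Complex.I) * α) * t * μ x by ring] at hm
        rw [hh]
        have h1 := hf x hx' _ hm
        have h2 := hφ x hx' _ hm
        fun_prop
    · refine norm_curve_integral_le huv hA₁ (fun x hx => hΦ x (hsub hx)) hα hε fun x hx => ?_
      have hx' := hsub hx
      have h1 := hbound x hx 1 (by simp)
      rw [Complex.ofReal_one, mul_one, mul_one, one_pow, mul_one] at h1
      refine h1.trans ?_
      have := hΦ x hx'
      gcongr
      refine curve_exponent_le (hμpos x hx') (hF x hx') hA₂ hA₃ hα hα2 hβ hβ0 ?_ (hqF x hx')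
      have := hf1 x hx' x (Metric.mem_closedBall_self (hμpos x hx').le)
      rwa [hd x hx', Complex.norm_real, Real.norm_eq_abs] at this

end SaddlePoint

theorem proposition1
    (a b : ℝ) (hab : a < b) (f φ : ℂ → ℂ) (μ F Φ : ℝ → ℝ) (A₁ A₂ A₃ : ℝ)
    -- `f` is real on `[a, b]`, with `f'' > 0` there
    (hfreal : ∀ x ∈ Set.Icc a b, (f (x : ℂ)).im = 0)
    (hfconvex : ∀ x ∈ Set.Icc a b, 0 < (deriv (deriv f) (x : ℂ)).re)
    -- the radius function
    (hμ : ContDiffOn ℝ 1 μ (Set.Icc a b))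
    (hμpos : ∀ x ∈ Set.Icc a b, 0 < μ x)
    -- holomorphy on (a neighbourhood of) the union of the closed discs
    (hf : AnalyticOnNhd ℂ f (⋃ x ∈ Set.Icc a b, Metric.closedBall (x : ℂ) (μ x)))
    (hφ : AnalyticOnNhd ℂ φ (⋃ x ∈ Set.Icc a b, Metric.closedBall (x : ℂ) (μ x)))
    -- the bounding functions and constants
    (hF : ∀ x ∈ Set.Icc a b, 0 < F x)
    (hΦ : ∀ x ∈ Set.Icc a b, 0 < Φ x)
    (hA₁ : 0 < A₁) (hA₂ : 0 < A₂) (hA₃ : 0 < A₃)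
    (hφbound : ∀ x ∈ Set.Icc a b, ∀ z ∈ Metric.closedBall (x : ℂ) (μ x),
      ‖φ z‖ ≤ A₁ * Φ x)
    (hf1bound : ∀ x ∈ Set.Icc a b, ∀ z ∈ Metric.closedBall (x : ℂ) (μ x),
      ‖deriv f z‖ ≤ A₂ * (F x / μ x))
    (hf2bound : ∀ x ∈ Set.Icc a b, ∀ z ∈ Metric.closedBall (x : ℂ) (μ x),
      deriv (deriv f) z ≠ 0 ∧ 1 / ‖deriv (deriv f) z‖ ≤ A₃ * (μ x ^ 2 / F x))
    (k α₀ : ℝ) (hα₀ : 0 < α₀)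
    (hα₀lt : α₀ < min (1 / ((1 + 2 * A₂ * A₃ / 3) * √2))
      (min (A₃ * (1 + 2 * A₂) / 2) ((48 * A₃ ^ 3 / π ^ 3) ^ (1 / 6 : ℝ)))) :
    (∀ x₀ ∈ Set.Icc a b, deriv f (x₀ : ℂ) = -(k : ℂ) →
      ∃ R₁ R₂ R₃ : ℂ,
        SaddlePoint.expIntegral a b k φ f
          = SaddlePoint.mainTerm k x₀ φ f + R₁ + R₂ + R₃ ∧
        ‖R₁‖ ≤ SaddlePoint.bound1 a b k f Φ A₁ A₂ A₃ α₀ ∧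
        ENNReal.ofReal ‖R₂‖ ≤ SaddlePoint.bound2 a b k F Φ μ A₁ A₂ A₃ α₀ ∧
        ‖R₃‖ ≤ SaddlePoint.bound3 x₀ F Φ μ A₁ A₂ A₃ α₀) ∧
    ((¬ ∃ x₀ ∈ Set.Icc a b, deriv f (x₀ : ℂ) = -(k : ℂ)) →
      ∃ R₁ R₂ : ℂ,
        SaddlePoint.expIntegral a b k φ f = R₁ + R₂ ∧
        ‖R₁‖ ≤ SaddlePoint.bound1 a b k f Φ A₁ A₂ A₃ α₀ ∧
        ENNReal.ofReal ‖R₂‖ ≤ SaddlePoint.bound2 a b k F Φ μ A₁ A₂ A₃ α₀) := by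
  have hball : ∀ x ∈ Set.Icc a b, Metric.closedBall (x : ℂ) (μ x)
      ⊆ ⋃ x ∈ Set.Icc a b, Metric.closedBall (x : ℂ) (μ x) := fun x hx =>
    Set.subset_biUnion_of_mem (u := fun x : ℝ => Metric.closedBall (x : ℂ) (μ x)) hx
  have hcenter : ∀ x ∈ Set.Icc a b, (x : ℂ) ∈ Metric.closedBall (x : ℂ) (μ x) := fun x hx =>
    Metric.mem_closedBall_self (hμpos x hx).le
  have hf' := fun x hx => hf.mono (hball x hx)
  have hφ' := fun x hx => hφ.mono (hball x hx)
  have hfan : ∀ x ∈ Set.Icc a b, AnalyticAt ℂ f (x : ℂ) := fun x hx =>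
    hf' x hx _ (hcenter x hx)
  have hd : ∀ x ∈ Set.Icc a b, deriv f (x : ℂ) = ((deriv f (x : ℂ)).re : ℂ) := fun x hx =>
    Complex.ext (by simp)
      (by simpa using SaddlePoint.im_deriv_eq_zero_of_real hab hfan hfreal hx)
  have hq : ∀ x ∈ Set.Icc a b,
      deriv (deriv f) (x : ℂ) = ((deriv (deriv f) (x : ℂ)).re : ℂ) := fun x hx => by
    have h := SaddlePoint.im_deriv_eq_zero_of_real hab (fun y hy => (hfan y hy).deriv)
      (fun y hy => SaddlePoint.im_deriv_eq_zero_of_real hab hfan hfreal hy) hx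
    exact Complex.ext (by simp) (by simpa using h)
  set d : ℝ → ℝ := fun x => (deriv f (x : ℂ)).re with hddef
  set q : ℝ → ℝ := fun x => (deriv (deriv f) (x : ℂ)).re with hqdef
  have hqF : ∀ x ∈ Set.Icc a b, F x ≤ A₃ * (μ x ^ 2 * q x) := fun x hx => by
    have h := (hf2bound x hx x (hcenter x hx)).2
    rw [hq x hx, Complex.norm_real, Real.norm_eq_abs, abs_of_pos (hfconvex x hx),
      ← mul_div_assoc, div_le_div_iff₀ (hfconvex x hx) (hF x hx)] at h
    simp only [hqdef]
    linarith
  -- Cauchy's estimate for f' at a gives μ²f'' ≤ A₂F, while `hqF` gives F ≤ A₃μ²f''.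
  have hA : 1 ≤ A₂ * A₃ := by
    have ha := Set.left_mem_Icc.2 hab.le
    have h := SaddlePoint.norm_iteratedDeriv_mul_pow_le (hμpos a ha) (hf' a ha).deriv
      (hf1bound a ha) 1
    rw [iteratedDeriv_one, hq a ha, Complex.norm_real, Real.norm_eq_abs,
      abs_of_pos (hfconvex a ha), Nat.factorial_one, Nat.cast_one, one_mul, pow_one,
      ← mul_div_assoc, le_div_iff₀ (hμpos a ha)] at h
    have h1 := hqF a ha
    have hFa := hF a ha
    have h2 : F a ≤ A₂ * A₃ * F a := by
      calc F a ≤ A₃ * (μ a ^ 2 * q a) := h1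
        _ = A₃ * (q a * μ a * μ a) := by ring
        _ ≤ A₃ * (A₂ * F a) := mul_le_mul_of_nonneg_left h hA₃.le
        _ = _ := by ring
    exact le_of_mul_le_mul_right (by rwa [one_mul]) hFa
  obtain ⟨hα1, hβ0, hβ, hα2, hα6⟩ :=
    SaddlePoint.parameter_consequences hA₂ hA₃ hA hα₀ hα₀lt
  have hα1' : α₀ * √2 < 1 := by linarith
  have hmono : StrictMonoOn d (Set.Icc a b) := by
    have hder : ∀ x ∈ Set.Icc a b, HasDerivAt d (q x) x := fun x hx =>
      (hfan x hx).deriv.differentiableAt.hasDerivAt.real_of_complex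
    refine strictMonoOn_of_deriv_pos (convex_Icc a b)
      (fun x hx => (hder x hx).continuousAt.continuousWithinAt) fun x hx => ?_
    have hx' := interior_subset hx
    rw [(hder x hx').deriv]
    exact hfconvex x hx'
  have hdcont : ContinuousOn d (Set.Icc a b) := fun x hx =>
    ((hfan x hx).deriv.differentiableAt.hasDerivAt.real_of_complex).continuousAt.continuousWithinAt
  obtain ⟨h, hh⟩ : ∃ h : ℂ → ℂ, h = fun z => φ z * Complex.exp (2 * π * Complex.I * (f z + k * z)) :=
    ⟨_, rfl⟩
  have hexp : SaddlePoint.expIntegral a b k φ f = ∫ x in a..b, h (x : ℂ) := by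
    rw [hh]; rfl
  have hnormd : ∀ x ∈ Set.Icc a b, ‖deriv f (x : ℂ) + (k : ℂ)‖ = |d x + k| := fun x hx => by
    rw [hd x hx, ← Complex.ofReal_add, Complex.norm_real, Real.norm_eq_abs]
  set S : ℝ → ℝ → ℂ := fun ε x => ∫ t in (0 : ℝ)..1,
      h (x + (ε * (1 + Complex.I) * α₀) * t * μ x) * ((ε * (1 + Complex.I) * α₀) * μ x) with hS
  have hshift := fun (u v ε : ℝ) huv hsub hε hεd =>
    SaddlePoint.exists_shifted_decomposition (u := u) (v := v) (k := k) (ε := ε) (Φ := Φ) (φ := φ)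
      hab huv hsub hμ hμpos hf' hφ' hF
      hΦ hA₁ hA₂ hA₃ hα₀ hα1' hα2 hβ hβ0 hφbound hf1bound hfreal hd hq hqF hε hεd hh
      (S := S ε) rfl
  have ha := Set.left_mem_Icc.2 hab.le
  have hb := Set.right_mem_Icc.2 hab.le
  have hbound1 : ∀ z w : ℂ,
      ‖z‖ ≤ A₁ * SaddlePoint.B1 A₂ A₃ α₀ * (Φ a / (|d a + k| + √(q a))) →
      ‖w‖ ≤ A₁ * SaddlePoint.B1 A₂ A₃ α₀ * (Φ b / (|d b + k| + √(q b))) →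
      ‖z - w‖ ≤ SaddlePoint.bound1 a b k f Φ A₁ A₂ A₃ α₀ := fun z w hz hw => by
    rw [SaddlePoint.bound1, hnormd a ha, hnormd b hb, mul_add]
    exact (norm_sub_le _ _).trans (add_le_add hz hw)
  constructor
  · intro x₀ hx₀ hk
    have hdx₀ : d x₀ + k = 0 := by
      simp only [hddef, hk, Complex.neg_re, Complex.ofReal_re, neg_add_cancel]
    have hsub1 : Set.Icc a x₀ ⊆ Set.Icc a b := Set.Icc_subset_Icc_right hx₀.2
    have hsub2 : Set.Icc x₀ b ⊆ Set.Icc a b := Set.Icc_subset_Icc_left hx₀.1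
    obtain ⟨hS1, C₁, hC₁, hC₁b⟩ := hshift a x₀ (-1) hx₀.1 hsub1 (by simp) fun x hx => by
      have : d x ≤ d x₀ := hmono.monotoneOn (hsub1 hx) hx₀ hx.2
      rw [abs_of_nonpos (by linarith)]; ring
    obtain ⟨hS2, C₂, hC₂, hC₂b⟩ := hshift x₀ b 1 hx₀.2 hsub2 (by simp) fun x hx => by
      have : d x₀ ≤ d x := hmono.monotoneOn hx₀ (hsub2 hx) hx.1
      rw [abs_of_nonneg (by linarith)]; ring
    have hhc : ∀ u v : ℝ, u ≤ v → Set.Icc u v ⊆ Set.Icc a b →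
        IntervalIntegrable (fun x : ℝ => h x) MeasureTheory.volume u v := fun u v huv hsub => by
      refine ContinuousOn.intervalIntegrable ?_
      rw [Set.uIcc_of_le huv]
      intro x hx
      have h1 := (hfan x (hsub hx)).continuousAt
      have h2 := (hφ' x (hsub hx) _ (hcenter x (hsub hx))).continuousAt
      have h3 : ContinuousAt h (x : ℂ) := by
        rw [hh]; fun_prop
      exact (h3.comp Complex.continuous_ofReal.continuousAt).continuousWithinAt
    have hr := hμpos x₀ hx₀
    have hsaddle := SaddlePoint.norm_saddle_integral_sub_mainTerm_le (k := k) (Φ := Φ x₀) hr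
      (hF x₀ hx₀) hA₁
      (hΦ x₀ hx₀) hA₂ hA₃ hα₀ (hf' x₀ hx₀) (hφ' x₀ hx₀) (hφbound x₀ hx₀) (hf1bound x₀ hx₀)
      (hfreal x₀ hx₀) hk (hq x₀ hx₀) (hqF x₀ hx₀) hβ hα1 hα6 hh
    have hseg : ∀ ε : ℝ, |ε| = 1 → IntervalIntegrable
        (fun s : ℝ => h (x₀ + μ x₀ * (ε * ((1 + Complex.I) * s)))) MeasureTheory.volume 0 α₀ :=
      fun ε hε => by
        refine ContinuousOn.intervalIntegrable ?_
        rw [Set.uIcc_of_le hα₀.le]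
        intro s hs
        have hz : ‖(ε * ((1 + Complex.I) * s) : ℂ)‖ ≤ 1 := by
          have := SaddlePoint.norm_direction (t := 1) hε hs.1 zero_le_one
          rw [Complex.ofReal_one, mul_one, mul_one, mul_assoc] at this
          rw [this]
          nlinarith [Real.sqrt_nonneg 2, hs.2]
        have hm := SaddlePoint.add_mul_mem_closedBall (x := (x₀ : ℂ)) hr.le hz
        have h1 := (hf' x₀ hx₀ _ hm).continuousAt
        have h2 := (hφ' x₀ hx₀ _ hm).continuousAt
        have h3 : ContinuousAt h (x₀ + μ x₀ * (ε * ((1 + Complex.I) * s))) := by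
          rw [hh]; fun_prop
        exact (h3.comp (f := fun s : ℝ => (x₀ : ℂ) + μ x₀ * (ε * ((1 + Complex.I) * s)))
          (by fun_prop)).continuousWithinAt
    -- The segments for ε = 1 and ε = -1 enter with opposite signs and together traverse the line
    -- through x₀ once, here folded at s = 0.
    have hSS : S 1 x₀ - S (-1) x₀ = (1 + Complex.I) * μ x₀ * (∫ s in (0 : ℝ)..α₀,
        (h (x₀ + μ x₀ * ((1 + Complex.I) * s)) + h (x₀ + μ x₀ * (-((1 + Complex.I) * s))))) := by
      have i1 := hseg 1 (by simp)
      have i2 := hseg (-1) (by simp)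
      simp only [hS, SaddlePoint.endpoint_integral_eq]
      push_cast at i1 i2 ⊢
      simp only [one_mul, neg_one_mul] at i1 i2 ⊢
      rw [intervalIntegral.integral_add i1 i2]
      ring
    -- R₁ consists of the outer segments, R₂ of the two curves, R₃ of the saddle segment minus the
    -- main term.
    refine ⟨S (-1) a - S 1 b, C₁ + C₂, S 1 x₀ - S (-1) x₀ - SaddlePoint.mainTerm k x₀ φ f,
      ?_, ?_, ?_, ?_⟩
    · rw [hexp, ← intervalIntegral.integral_add_adjacent_intervals (hhc a x₀ hx₀.1 hsub1)
        (hhc x₀ b hx₀.2 hsub2), hC₁, hC₂]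
      ring
    · exact hbound1 _ _ (hS1 a (Set.left_mem_Icc.2 hx₀.1)) (hS2 b (Set.right_mem_Icc.2 hx₀.2))
    · calc ENNReal.ofReal ‖C₁ + C₂‖ ≤ ENNReal.ofReal ‖C₁‖ + ENNReal.ofReal ‖C₂‖ :=
            (ENNReal.ofReal_le_ofReal (norm_add_le _ _)).trans ENNReal.ofReal_add_le
        _ ≤ _ := add_le_add hC₁b hC₂b
        _ ≤ _ := by
            -- Half-open pieces are disjoint, so their integrals add exactly; only measurability of
            -- the sets is needed.
            rw [← mul_add, SaddlePoint.bound2, ← MeasureTheory.lintegral_union measurableSet_Ioc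
              (Set.Ioc_disjoint_Ioc_of_le le_rfl), Set.Ioc_union_Ioc_eq_Ioc hx₀.1 hx₀.2]
            gcongr
            exact Set.Ioc_subset_Icc_self
    · rw [hSS]
      exact hsaddle
  · intro hno
    have hconcl : ∀ ε : ℝ, |ε| = 1 → (∀ x ∈ Set.Icc a b, ε * (d x + k) = |d x + k|) →
        ∃ R₁ R₂ : ℂ, SaddlePoint.expIntegral a b k φ f = R₁ + R₂ ∧
        ‖R₁‖ ≤ SaddlePoint.bound1 a b k f Φ A₁ A₂ A₃ α₀ ∧
        ENNReal.ofReal ‖R₂‖ ≤ SaddlePoint.bound2 a b k F Φ μ A₁ A₂ A₃ α₀ := fun ε hε hεd => by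
      obtain ⟨hS1, C, hC, hCb⟩ := hshift a b ε hab.le subset_rfl hε hεd
      refine ⟨S ε a - S ε b, C, ?_, hbound1 _ _ (hS1 a ha) (hS1 b hb), hCb.trans ?_⟩
      · rw [hexp, hC]; ring
      · rw [SaddlePoint.bound2]
        gcongr
        exact Set.Ioc_subset_Icc_self
    rcases le_or_gt 0 (d a + k) with h0 | h0
    · refine hconcl 1 (by simp) fun x hx => ?_
      have : d a ≤ d x := hmono.monotoneOn ha hx hx.1
      rw [abs_of_nonneg (by linarith), one_mul]
    · refine hconcl (-1) (by simp) fun x hx => ?_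
      -- If f'+k is negative at a, a positive value later would force a zero by the intermediate
      -- value theorem.
      have hx0 : d x + k ≤ 0 := by
        by_contra! hpos
        obtain ⟨y, hy, hy0⟩ := intermediate_value_Icc hx.1
          (hdcont.mono (Set.Icc_subset_Icc_right hx.2))
          (⟨by linarith, by linarith⟩ : -k ∈ Set.Icc (d a) (d x))
        have hy' := Set.Icc_subset_Icc_right hx.2 hy
        exact hno ⟨y, hy', by rw [hd y hy', ← Complex.ofReal_neg, ← hy0]⟩
      rw [abs_of_nonpos hx0]; ring
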